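/- Let $d\ge 2$, $1\le k\le d-1$ and $\vartheta\ge 1$, and fix a field $\mathbb K$. For a finite set $P\subset\mathbb R^d$ and $r>0$, let $\check{C}ech_r(P)$ be the abstract simplicial complex of all nonempty $Q\subseteq P$ with $\bigcap_{x\in Q}\overline B_r(x)\neq\emptyset$, where $\overline B_r(x)$ is the closed Euclidean ball. Let $Z_k$, $B_k$ and $H_k$ denote simplicial $k$-cycles, $k$-boundaries and $k$-th homology with coefficients in $\mathbb K$. The $k$-th $\vartheta$-persistent Betti number is $$\beta_k^\vartheta(P,r)=\operatorname{rank}\bigl(H_k(\check{C}ech_r(P))\to H_k(\check{C}ech_{\vartheta r}(P))\bigr),$$ the map being induced by inclusion. Say that a finite set $P\subset\mathbb R^d$ forms a $\vartheta$-persistent $k$-cycle if for some $r>0$ there is $\gamma\in Z_k(\check{C}ech_r(P))$ with $\gamma\notin B_k(\check{C}ech_{\vartheta r}(P))$, and let $$m=m(\vartheta,k)=\min\{|P| : P\subset\mathbb R^d \text{ finite and forms a } \vartheta\text{-persistent } k\text{-cycle}\}$$ (for the fixed $d$ and $\mathbb K$). Let $f$ be a bounded probability density on $\mathbb R^d$.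 For each $n\in\mathbb N$ let $\mathcal P_n$ be a Poisson process on $\mathbb R^d$ with intensity function $x\mapsto n f(x)$, that is, a random finite set of points such that for each Borel set $A$ the number $|\mathcal P_n\cap A|$ is a Poisson random variable with parameter $\int_A n f(x)\,dx$, and such that the numbers of points in pairwise disjoint Borel sets are mutually independent. Let $r_n>0$ be radii with $r_n^d\,n\to 0$ as $n\to\infty$. Then the minimum defining $m$ is attained by some finite set, $\beta_k^\vartheta(\mathcal P_n,r_n)$ is an integrable random variable for every $n$, and $$\mathbb E\bigl(\beta_k^\vartheta(\mathcal P_n,r_n)\bigr)\in\Theta\bigl(n\,(r_n^d\,n)^{m-1}\bigr)\qquad (n\to\infty),$$ i.e. there are constants $0<c<C$ and $n_0$ such that $c\,n(r_n^dn)^{m-1}\le \mathbb E(\beta_k^\vartheta(\mathcal P_n,r_n))\le C\,n(r_n^dn)^{m-1}$ for all $n> n_0$. -/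

import Mathlib

set_option maxSynthPendingDepth 3

open MeasureTheory ProbabilityTheory Filter Topology Asymptotics

noncomputable section

namespace RandomCech

/-! ### Simplicial homology with coefficients in a field

Homology of an abstract simplicial complex is computed by ordered simplicial chains: a basis of
the `k`-chains of `K` is given by the `(k+1)`-tuples of (not necessarily distinct) vertices that
lie in a common face of `K`. -/

section Homology

variable (𝕜 : Type*) [Field 𝕜] {V : Type*}

/-- The `k`-chains of `K`, inside the space of all finite formal combinations of
`(k+1)`-tuples of points. -/
def chains (K : PreAbstractSimplicialComplex V) (k : ℕ) :
    Submodule 𝕜 ((Fin (k + 1) → V) →₀ 𝕜) :=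
  Finsupp.supported 𝕜 𝕜 {x | ∃ s ∈ K, ∀ i, x i ∈ s}

/-- The simplicial boundary operator from degree `k + 1` to degree `k`:
`∂ (v₀, …, v_{k+1}) = ∑ i, (-1) ^ i (v₀, …, v̂ᵢ, …, v_{k+1})`. -/
def boundary (V : Type*) (k : ℕ) :
    ((Fin (k + 2) → V) →₀ 𝕜) →ₗ[𝕜] ((Fin (k + 1) → V) →₀ 𝕜) :=
  ∑ i : Fin (k + 2),
    ((-1 : 𝕜) ^ (i : ℕ)) • Finsupp.lmapDomain 𝕜 𝕜 (fun x : Fin (k + 2) → V => x ∘ i.succAbove)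

/-- The `k`-cycles `Z_k(K)`. -/
def cycles (K : PreAbstractSimplicialComplex V) : (k : ℕ) → Submodule 𝕜 ((Fin (k + 1) → V) →₀ 𝕜)
  | 0 => chains 𝕜 K 0
  | k + 1 => chains 𝕜 K (k + 1) ⊓ LinearMap.ker (boundary 𝕜 V k)

/-- The `k`-boundaries `B_k(K)`. -/
def boundaries (K : PreAbstractSimplicialComplex V) (k : ℕ) :
    Submodule 𝕜 ((Fin (k + 1) → V) →₀ 𝕜) :=
  (chains 𝕜 K (k + 1)).map (boundary 𝕜 V k)

/-- The homology `H_k(K) = Z_k(K) / B_k(K)`. -/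
abbrev Homology (K : PreAbstractSimplicialComplex V) (k : ℕ) : Type _ :=
  cycles 𝕜 K k ⧸ (boundaries 𝕜 K k).submoduleOf (cycles 𝕜 K k)

variable {𝕜}

theorem boundary_single {k : ℕ} (x : Fin (k + 2) → V) (a : 𝕜) :
    boundary 𝕜 V k (Finsupp.single x a) =
      ∑ i : Fin (k + 2), Finsupp.single (x ∘ i.succAbove) ((-1 : 𝕜) ^ (i : ℕ) * a) := by
  simp [boundary, Finsupp.mapDomain_single]

theorem chains_mono {K L : PreAbstractSimplicialComplex V} (h : K ≤ L) (k : ℕ) :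
    chains 𝕜 K k ≤ chains 𝕜 L k :=
  Finsupp.supported_mono fun _ ⟨s, hs, hx⟩ => ⟨s, h hs, hx⟩

theorem cycles_mono {K L : PreAbstractSimplicialComplex V} (h : K ≤ L) :
    ∀ k : ℕ, cycles 𝕜 K k ≤ cycles 𝕜 L k
  | 0 => chains_mono h 0
  | k + 1 => inf_le_inf_right _ (chains_mono h (k + 1))

theorem boundaries_mono {K L : PreAbstractSimplicialComplex V} (h : K ≤ L) (k : ℕ) :
    boundaries 𝕜 K k ≤ boundaries 𝕜 L k :=
  Submodule.map_mono (chains_mono h (k + 1))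

variable (𝕜)

/-- The map `H_k(K) → H_k(L)` induced by the inclusion of a subcomplex `K` of `L`. -/
def homologyMap {K L : PreAbstractSimplicialComplex V} (h : K ≤ L) (k : ℕ) :
    Homology 𝕜 K k →ₗ[𝕜] Homology 𝕜 L k :=
  Submodule.mapQ _ _ (Submodule.inclusion (cycles_mono h k)) fun _ hz => boundaries_mono h k hz

theorem boundary_boundary (k : ℕ) (c : (Fin (k + 3) → V) →₀ 𝕜) :
    boundary 𝕜 V k (boundary 𝕜 V (k + 1) c) = 0 := by
  induction c using Finsupp.induction_linear with
  | zero => simp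
  | add c c' hc hc' => simp [hc, hc']
  | single x a =>
    simp only [boundary_single, map_sum]
    rw [← Finset.sum_product', Finset.univ_product_univ]
    refine Finset.sum_involution (fun p _ => (p.1.succAbove p.2, p.2.predAbove p.1)) ?_ ?_ ?_ ?_
    · rintro ⟨i, j⟩ -
      have hx : (x ∘ (i.succAbove j).succAbove) ∘ (j.predAbove i).succAbove =
          (x ∘ i.succAbove) ∘ j.succAbove := by
        funext l
        simp [Fin.succAbove_succAbove_succAbove_predAbove]
      have hs : (-1 : 𝕜) ^ ((i.succAbove j : ℕ) + (j.predAbove i : ℕ)) =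
          -(-1) ^ ((i : ℕ) + (j : ℕ)) := by
        rcases Nat.even_or_odd ((i : ℕ) + (j : ℕ)) with h | h
        · have h' := Fin.even_succAbove_add_predAbove i j
          rw [← Nat.not_even_iff_odd, ← not_iff_not, not_not] at h'
          rw [h.neg_one_pow, (Nat.not_even_iff_odd.1 (h'.2 h)).neg_one_pow]
        · rw [h.neg_one_pow, ((Fin.even_succAbove_add_predAbove i j).2 h).neg_one_pow, neg_neg]
      rw [hx, ← Finsupp.single_add, Finsupp.single_eq_zero, ← mul_assoc, ← mul_assoc, ← pow_add,
        ← pow_add, add_comm (j.predAbove i : ℕ), hs, add_comm (j : ℕ)]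
      ring
    · rintro ⟨i, j⟩ - - h
      exact Fin.succAbove_ne i j (congrArg Prod.fst h)
    · simp
    · rintro ⟨i, j⟩ -
      have h₁ := Fin.succAbove_succAbove_predAbove i j
      refine Prod.ext h₁ ?_
      apply Fin.succAbove_right_injective (p := i)
      have h₂ := Fin.succAbove_succAbove_predAbove (i.succAbove j) (j.predAbove i)
      simp only [h₁] at h₂ ⊢
      exact h₂

theorem chains_boundary {K : PreAbstractSimplicialComplex V} {k : ℕ}
    {c : (Fin (k + 2) → V) →₀ 𝕜} (hc : c ∈ chains 𝕜 K (k + 1)) :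
    boundary 𝕜 V k c ∈ chains 𝕜 K k := by
  simp only [boundary, LinearMap.sum_apply, LinearMap.smul_apply]
  refine Submodule.sum_mem _ fun i _ => Submodule.smul_mem _ _ ?_
  rw [chains, Finsupp.mem_supported] at hc ⊢
  classical
  intro y hy
  obtain ⟨x, hx, rfl⟩ := Finset.mem_image.1 (Finsupp.mapDomain_support (Finset.mem_coe.1 hy))
  obtain ⟨s, hs, hxs⟩ := hc hx
  exact ⟨s, hs, fun l => hxs _⟩

/-- Boundaries are cycles, so that `Homology` is the quotient by all of `B_k(K)`. -/
theorem boundaries_le_cycles (K : PreAbstractSimplicialComplex V) :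
    ∀ k : ℕ, boundaries 𝕜 K k ≤ cycles 𝕜 K k
  | 0 => by
    rintro _ ⟨c, hc, rfl⟩
    exact chains_boundary 𝕜 hc
  | k + 1 => by
    rintro _ ⟨c, hc, rfl⟩
    exact ⟨chains_boundary 𝕜 hc, boundary_boundary 𝕜 k c⟩

end Homology

/-! ### Čech complexes and persistent Betti numbers -/

/-- Euclidean space `ℝ^d`. -/
abbrev E (d : ℕ) : Type := EuclideanSpace ℝ (Fin d)

/-- The Čech complex of a finite point set `P` at radius `r`: its faces are the nonempty `Q ⊆ P`
for which the closed balls of radius `r` around the points of `Q` have a common point. -/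
def cech {d : ℕ} (P : Finset (E d)) (r : ℝ) : PreAbstractSimplicialComplex (E d) where
  faces := {Q | Q.Nonempty ∧ Q ⊆ P ∧ (⋂ x ∈ Q, Metric.closedBall x r).Nonempty}
  isRelLowerSet_faces := fun _ ⟨hne, hP, hQ⟩ =>
    ⟨hne, fun _ hts ht => ⟨ht, hts.trans hP,
      hQ.mono (Set.biInter_subset_biInter_left fun _ hx => hts hx)⟩⟩

theorem cech_mono {d : ℕ} (P : Finset (E d)) {r s : ℝ} (h : r ≤ s) : cech P r ≤ cech P s :=
  fun _ ⟨hne, hP, hQ⟩ => ⟨hne, hP,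
    hQ.mono (Set.iInter₂_mono fun _ _ => Metric.closedBall_subset_closedBall h)⟩

/-- The `k`-th `ϑ`-persistent Betti number of `P` at radius `r`: the rank of the map
`H_k(Čech_r(P)) → H_k(Čech_{ϑ r}(P))` induced by inclusion. -/
def persistentBetti (𝕜 : Type*) [Field 𝕜] {d : ℕ} (k : ℕ) {ϑ r : ℝ} (hϑ : 1 ≤ ϑ) (hr : 0 ≤ r)
    (P : Finset (E d)) : ℕ :=
  Module.finrank 𝕜
    (LinearMap.range (homologyMap 𝕜 (cech_mono P (le_mul_of_one_le_left hr hϑ)) k))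

/-- `P` forms a `ϑ`-persistent `k`-cycle: for some `r > 0` there is a `k`-cycle of `Čech_r(P)` that
is not a `k`-boundary of `Čech_{ϑ r}(P)`. -/
def FormsPersistentCycle (𝕜 : Type*) [Field 𝕜] {d : ℕ} (k : ℕ) (ϑ : ℝ) (P : Finset (E d)) : Prop :=
  ∃ r : ℝ, 0 < r ∧ ∃ γ ∈ cycles 𝕜 (cech P r) k, γ ∉ boundaries 𝕜 (cech P (ϑ * r)) k

/-- The cardinalities of the finite point sets in `ℝ^d` that form a `ϑ`-persistent `k`-cycle. -/
def persistentCycleSizes (𝕜 : Type*) [Field 𝕜] (d k : ℕ) (ϑ : ℝ) : Set ℕ :=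
  {j | ∃ P : Finset (E d), FormsPersistentCycle 𝕜 k ϑ P ∧ P.card = j}

/-- `m(ϑ, k)`: the minimal number of points of `ℝ^d` that form a `ϑ`-persistent `k`-cycle. -/
def minCycleSize (𝕜 : Type*) [Field 𝕜] (d k : ℕ) (ϑ : ℝ) : ℕ :=
  sInf (persistentCycleSizes 𝕜 d k ϑ)

/-! ### Poisson processes -/

/-- The random finite point set `P`, defined on the probability space `(Ω, μ)`, is a Poisson
process in `ℝ^d` with intensity function `lam`: the number of points in each Borel set `A` is a
random variable, it has Poisson distribution with parameter `∫_A lam` whenever that integral is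
finite, and the numbers of points in disjoint Borel sets are mutually independent. -/
structure IsPoissonProcess {d : ℕ} {Ω : Type*} [MeasurableSpace Ω] (P : Ω → Finset (E d))
    (lam : E d → ℝ) (μ : Measure Ω) : Prop where
  measurable_count : ∀ A : Set (E d), MeasurableSet A →
    Measurable fun ω => ((P ω : Set (E d)) ∩ A).ncard
  hasLaw_count : ∀ A : Set (E d), MeasurableSet A →
    ∫⁻ x in A, ENNReal.ofReal (lam x) ≠ ⊤ →
      HasLaw (fun ω => ((P ω : Set (E d)) ∩ A).ncard)
        (poissonMeasure (∫⁻ x in A, ENNReal.ofReal (lam x)).toNNReal) μ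
  indep_count : ∀ (j : ℕ) (A : Fin j → Set (E d)), (∀ i, MeasurableSet (A i)) →
    Pairwise (fun i i' => Disjoint (A i) (A i')) →
      iIndepFun (fun i ω => ((P ω : Set (E d)) ∩ A i).ncard) μ

end RandomCech

end

/-! In the sparse regime `r ^ d * n → 0`, clusters of points at scale `r` are small, and the
expectation is governed by the cheapest cluster that carries a persistent cycle. A cluster of `m`
points within distance `O(r)` of each other costs one free position (a factor `n`) and `m - 1`
further points near it (a factor `r ^ d * n` each).

The minimum exists because some finite set forms a persistent cycle. Subdivide the boundary of a `(k
+ 1)`-simplex finely and label points by a large barycentric coordinate, as in Sperner's lemma. The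
cochain counting labels is 1 on the subdivided boundary, yet vanishes on boundaries at a small
enough radius (`persistentCycleSizes_nonempty`).

Upper bound: a cycle splits along the connected components at radius `r`. Components with fewer than
`m` points contribute only boundaries at radius `ϑ * r`, so the rank is at most the number of `(k +
1)`-tuples with at least `m` points nearby (`persistentRank_cech_le`). Localised to grid cells, this
is a sum of Poisson moments truncated below `m`; each is `O(Λ ^ m)`, where `Λ = O(r ^ d * n)` is the
mass around the cell, and the masses sum to `O(n)`.

Lower bound: a minimal persistent configuration survives scaling and small perturbation
(`exists_stable_configuration`). Grid cells containing such a copy, well inside the cell and nothing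
else, give independent classes (`card_hasConfig_le`). Independence of the Poisson counts bounds the
probability of each cell below by a product of ball masses. Lebesgue differentiation and Fatou bound
the sum of these products below by a multiple of `∫ f ^ m > 0` (`exists_le_tsum_prod_configBall`).

Measurability is reduced to counts by rounding the points to ever finer grids; integrability follows
from Poisson moments. -/

noncomputable section

namespace RandomCech

/-! ### Linear algebra of chain groups -/

section Algebra

variable (𝕜 : Type*) [Field 𝕜] {V V' : Type*}

/-- The rank of the image of `Z_k(K)` modulo `B_k(L)`. -/
def persistentRank (K L : PreAbstractSimplicialComplex V) (k : ℕ) : ℕ :=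
  Module.finrank 𝕜 ((cycles 𝕜 K k).map (boundaries 𝕜 L k).mkQ)

/-- `H_k(L)` embeds into all chains modulo `B_k(L)`, and the embedding carries the range onto the
image of `Z_k(K)`. All later arguments can then stay in one ambient chain space. -/
theorem finrank_range_homologyMap {K L : PreAbstractSimplicialComplex V} (h : K ≤ L) (k : ℕ) :
    Module.finrank 𝕜 (LinearMap.range (homologyMap 𝕜 h k)) = persistentRank 𝕜 K L k := by
  set B := boundaries 𝕜 L k
  let ι : Homology 𝕜 L k →ₗ[𝕜] (((Fin (k + 1) → V) →₀ 𝕜) ⧸ B) :=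
    Submodule.mapQ _ B (cycles 𝕜 L k).subtype le_rfl
  have hι : Function.Injective ι := by
    rw [← LinearMap.ker_eq_bot]
    exact (Submodule.ker_mapQ _ _ _ _).trans (Submodule.mkQ_map_self _)
  have h1 : (LinearMap.range (homologyMap 𝕜 h k)).map ι = (cycles 𝕜 K k).map B.mkQ := by
    ext y
    constructor
    · rintro ⟨_, ⟨z, rfl⟩, rfl⟩
      obtain ⟨z, rfl⟩ := Submodule.mkQ_surjective _ z
      exact ⟨z, z.2, rfl⟩
    · rintro ⟨z, hz, rfl⟩
      exact ⟨_, ⟨Submodule.Quotient.mk ⟨z, hz⟩, rfl⟩, rfl⟩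
  rw [persistentRank, ← h1]
  exact (LinearEquiv.finrank_eq (Submodule.equivMapOfInjective ι hι _))

variable {𝕜}

/-- Evaluation at the points of `S` has its kernel on `Z` inside `B`, so `Z` modulo `B` is a
quotient of a subspace of `S → 𝕜`. -/
theorem finrank_map_mkQ_le_card {ι : Type*} (Z B : Submodule 𝕜 (ι →₀ 𝕜)) (S : Finset ι)
    (h : ∀ z ∈ Z, (∀ x ∈ S, z x = 0) → z ∈ B) :
    Module.finrank 𝕜 (Z.map B.mkQ) ≤ S.card := by
  let q : Z →ₗ[𝕜] ((ι →₀ 𝕜) ⧸ B) := B.mkQ ∘ₗ Z.subtype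
  let ρ : Z →ₗ[𝕜] (S → 𝕜) := LinearMap.pi fun x => Finsupp.lapply (x : ι) ∘ₗ Z.subtype
  have hker : LinearMap.ker ρ ≤ LinearMap.ker q := by
    intro z hz
    rw [LinearMap.mem_ker] at hz ⊢
    have : (z : ι →₀ 𝕜) ∈ B := h z z.2 fun x hx => congrFun hz ⟨x, hx⟩
    simpa [q] using this
  have hq : Z.map B.mkQ = LinearMap.range ((LinearMap.ker ρ).liftQ q hker) := by
    rw [Submodule.range_liftQ, LinearMap.range_comp, Submodule.range_subtype]
  rw [hq]
  have e := ρ.quotKerEquivRange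
  have : FiniteDimensional 𝕜 (Z ⧸ LinearMap.ker ρ) := Module.Finite.equiv e.symm
  calc _ ≤ Module.finrank 𝕜 (Z ⧸ LinearMap.ker ρ) := LinearMap.finrank_range_le _
    _ = Module.finrank 𝕜 (LinearMap.range ρ) := e.finrank_eq
    _ ≤ Module.finrank 𝕜 (S → 𝕜) := Submodule.finrank_le _
    _ = S.card := by simp

theorem card_le_finrank_map_mkQ {A τ : Type*} [AddCommGroup A] [Module 𝕜 A] (Z B : Submodule 𝕜 A)
    [FiniteDimensional 𝕜 Z] (T : Finset τ) (γ : τ → A) (hγ : ∀ t ∈ T, γ t ∈ Z)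
    (h : ∀ a : τ → 𝕜, ∑ t ∈ T, a t • γ t ∈ B → ∀ t ∈ T, a t = 0) :
    T.card ≤ Module.finrank 𝕜 (Z.map B.mkQ) := by
  classical
  let v : T → Z.map B.mkQ := fun t => ⟨B.mkQ (γ t), ⟨γ t, hγ t t.2, rfl⟩⟩
  have hv : LinearIndependent 𝕜 v := by
    rw [Fintype.linearIndependent_iff]
    intro g hg t
    let a : τ → 𝕜 := fun s => if hs : s ∈ T then g ⟨s, hs⟩ else 0
    have ha : ∀ s : T, a s = g s := fun s => by simp [a]
    rw [← ha]
    refine h a ?_ t t.2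
    have h2 := congrArg Subtype.val hg
    rw [← Submodule.Quotient.mk_eq_zero, ← Submodule.mkQ_apply, map_sum, ← Finset.sum_coe_sort]
    simp only [AddSubmonoidClass.coe_finsetSum, SetLike.val_smul, ZeroMemClass.coe_zero] at h2
    rw [← h2]
    exact Finset.sum_congr rfl fun s _ => by rw [map_smul, ha]
  have := hv.fintype_card_le_finrank
  simpa using this

variable (𝕜) in
/-- The map on tuples induced by a vertex map. -/
def vertexMap (f : V → V') (n : ℕ) : ((Fin n → V) →₀ 𝕜) →ₗ[𝕜] ((Fin n → V') →₀ 𝕜) :=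
  Finsupp.lmapDomain 𝕜 𝕜 (fun x => f ∘ x)

theorem vertexMap_single (f : V → V') {n : ℕ} (x : Fin n → V) (a : 𝕜) :
    vertexMap 𝕜 f n (Finsupp.single x a) = Finsupp.single (f ∘ x) a := by
  simp [vertexMap, Finsupp.mapDomain_single]

/-- Ordered chains allow repeated vertices, so a non-injective vertex map creates no degenerate
case. -/
theorem boundary_vertexMap (f : V → V') (k : ℕ) (c : (Fin (k + 2) → V) →₀ 𝕜) :
    boundary 𝕜 V' k (vertexMap 𝕜 f _ c) = vertexMap 𝕜 f _ (boundary 𝕜 V k c) := by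
  induction c using Finsupp.induction_linear with
  | zero => simp
  | add c c' hc hc' => simp [hc, hc']
  | single x a =>
    simp only [vertexMap_single, boundary_single, map_sum]
    rfl

theorem single_mem_chains {K : PreAbstractSimplicialComplex V} {k : ℕ} {x : Fin (k + 1) → V}
    (a : 𝕜) (hx : ∃ s ∈ K, ∀ i, x i ∈ s) : Finsupp.single x a ∈ chains 𝕜 K k :=
  Finsupp.single_mem_supported _ _ hx

@[elab_as_elim]
theorem chains_induction {K : PreAbstractSimplicialComplex V} {k : ℕ}
    {p : (c : (Fin (k + 1) → V) →₀ 𝕜) → c ∈ chains 𝕜 K k → Prop} (h0 : p 0 (zero_mem _))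
    (hadd : ∀ c c' hc hc', p c hc → p c' hc' → p (c + c') (add_mem hc hc'))
    (hs : ∀ x a (hx : ∃ s ∈ K, ∀ i, x i ∈ s), p (Finsupp.single x a) (single_mem_chains a hx))
    {c : (Fin (k + 1) → V) →₀ 𝕜} (hc : c ∈ chains 𝕜 K k) : p c hc := by
  suffices h : ∃ h, p c h from h.2
  have hc' := (Finsupp.mem_supported _ _).1 hc
  rw [← Finsupp.sum_single c, Finsupp.sum]
  refine Finset.sum_induction _ (fun c => ∃ h, p c h) ?_ ⟨_, h0⟩ fun x hx => ⟨_, hs _ _ (hc' hx)⟩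
  rintro a b ⟨_, ha⟩ ⟨_, hb⟩
  exact ⟨_, hadd _ _ _ _ ha hb⟩

/-- A vertex map that sends faces of `K` into faces of `K'`. -/
def IsSimplicial (K : PreAbstractSimplicialComplex V) (K' : PreAbstractSimplicialComplex V')
    (f : V → V') : Prop :=
  ∀ s ∈ K, ∃ s' ∈ K', ∀ x ∈ s, f x ∈ s'

theorem IsSimplicial.vertexMap_mem_chains {K : PreAbstractSimplicialComplex V}
    {K' : PreAbstractSimplicialComplex V'} {f : V → V'} (hf : IsSimplicial K K' f) {k : ℕ}
    {c : (Fin (k + 1) → V) →₀ 𝕜} (hc : c ∈ chains 𝕜 K k) :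
    vertexMap 𝕜 f _ c ∈ chains 𝕜 K' k := by
  induction hc using chains_induction with
  | h0 => simp
  | hadd c c' _ _ h h' => rw [map_add]; exact add_mem h h'
  | hs x a hx =>
    obtain ⟨s, hs, hxs⟩ := hx
    obtain ⟨s', hs', h⟩ := hf s hs
    rw [vertexMap_single]
    exact single_mem_chains _ ⟨s', hs', fun i => h _ (hxs i)⟩

theorem cycles_le_chains (K : PreAbstractSimplicialComplex V) :
    ∀ k, cycles 𝕜 K k ≤ chains 𝕜 K k
  | 0 => le_rfl
  | _ + 1 => inf_le_left

theorem IsSimplicial.vertexMap_mem_cycles {K : PreAbstractSimplicialComplex V}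
    {K' : PreAbstractSimplicialComplex V'} {f : V → V'} (hf : IsSimplicial K K' f) {k : ℕ}
    {c : (Fin (k + 1) → V) →₀ 𝕜} (hc : c ∈ cycles 𝕜 K k) :
    vertexMap 𝕜 f _ c ∈ cycles 𝕜 K' k := by
  cases k with
  | zero => exact hf.vertexMap_mem_chains hc
  | succ k =>
    refine ⟨hf.vertexMap_mem_chains hc.1, ?_⟩
    rw [SetLike.mem_coe, LinearMap.mem_ker, boundary_vertexMap, LinearMap.mem_ker.1 hc.2, map_zero]

theorem IsSimplicial.vertexMap_mem_boundaries {K : PreAbstractSimplicialComplex V}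
    {K' : PreAbstractSimplicialComplex V'} {f : V → V'} (hf : IsSimplicial K K' f) {k : ℕ}
    {c : (Fin (k + 1) → V) →₀ 𝕜} (hc : c ∈ boundaries 𝕜 K k) :
    vertexMap 𝕜 f _ c ∈ boundaries 𝕜 K' k := by
  obtain ⟨b, hb, rfl⟩ := hc
  exact ⟨_, hf.vertexMap_mem_chains hb, boundary_vertexMap f k b⟩

theorem vertexMap_vertexMap_of_mem_chains {K : PreAbstractSimplicialComplex V} {f : V → V'}
    {g : V' → V} (hgf : ∀ s ∈ K, ∀ x ∈ s, g (f x) = x) {k : ℕ}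
    {c : (Fin (k + 1) → V) →₀ 𝕜} (hc : c ∈ chains 𝕜 K k) :
    vertexMap 𝕜 g _ (vertexMap 𝕜 f _ c) = c := by
  induction hc using chains_induction with
  | h0 => simp
  | hadd c c' _ _ h h' => rw [map_add, map_add, h, h']
  | hs x a hx =>
    obtain ⟨s, hs, hxs⟩ := hx
    rw [vertexMap_single, vertexMap_single]
    congr 1
    funext i
    exact hgf s hs _ (hxs i)

theorem finiteDimensional_chains {K : PreAbstractSimplicialComplex V} (P : Finset V)
    (hP : ∀ s ∈ K, s ⊆ P) (k : ℕ) : FiniteDimensional 𝕜 (chains 𝕜 K k) := by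
  classical
  have hfin : {x : Fin (k + 1) → V | ∃ s ∈ K, ∀ i, x i ∈ s}.Finite := by
    refine (Fintype.piFinset fun _ : Fin (k + 1) => P).finite_toSet.subset ?_
    rintro x ⟨s, hs, hx⟩
    simpa using fun i => hP s hs (hx i)
  have := hfin.to_subtype
  exact Module.Finite.equiv (Finsupp.supportedEquivFinsupp _).symm

theorem finiteDimensional_cycles {K : PreAbstractSimplicialComplex V} (P : Finset V)
    (hP : ∀ s ∈ K, s ⊆ P) (k : ℕ) : FiniteDimensional 𝕜 (cycles 𝕜 K k) := by
  have := finiteDimensional_chains (𝕜 := 𝕜) P hP k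
  exact Submodule.finiteDimensional_of_le (cycles_le_chains K k)

/-- The persistent rank of a retract is at most that of the ambient pair. -/
theorem persistentRank_le_of_retract {K L : PreAbstractSimplicialComplex V}
    {K' L' : PreAbstractSimplicialComplex V'} (P' : Finset V') (hP' : ∀ s ∈ K', s ⊆ P')
    {f : V → V'} {g : V' → V} (hf : IsSimplicial K K' f) (hg : IsSimplicial L' L g)
    (hgf : ∀ s ∈ K, ∀ x ∈ s, g (f x) = x) (k : ℕ) :
    persistentRank 𝕜 K L k ≤ persistentRank 𝕜 K' L' k := by
  have := finiteDimensional_cycles (𝕜 := 𝕜) P' hP' k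
  -- The class of `z` is the `G`-image of the class of its pushforward under `f`, because `g` undoes
  -- `f` on chains of `K`.
  let G := Submodule.mapQ (boundaries 𝕜 L' k) (boundaries 𝕜 L k) (vertexMap 𝕜 g _)
    fun c hc => hg.vertexMap_mem_boundaries hc
  have hle : (cycles 𝕜 K k).map (boundaries 𝕜 L k).mkQ ≤
      ((cycles 𝕜 K' k).map (boundaries 𝕜 L' k).mkQ).map G := by
    rintro _ ⟨z, hz, rfl⟩
    refine ⟨_, ⟨_, hf.vertexMap_mem_cycles hz, rfl⟩, ?_⟩
    rw [Submodule.mkQ_apply, Submodule.mapQ_apply,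
      vertexMap_vertexMap_of_mem_chains hgf (cycles_le_chains K k hz)]
    rfl
  exact (Submodule.finrank_mono hle).trans (Submodule.finrank_map_le _ _)

open Classical in
variable (𝕜) in
/-- The part of a chain supported on tuples of elements of `A`. -/
def restrict (A : Set V) (n : ℕ) : ((Fin n → V) →₀ 𝕜) →ₗ[𝕜] ((Fin n → V) →₀ 𝕜) where
  toFun := Finsupp.filter fun x => ∀ i, x i ∈ A
  map_add' _ _ := Finsupp.filter_add
  map_smul' _ _ := Finsupp.filter_smul

theorem restrict_apply_of_mem {A : Set V} {n : ℕ} (c : (Fin n → V) →₀ 𝕜) {x : Fin n → V}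
    (hx : ∀ i, x i ∈ A) : restrict 𝕜 A n c x = c x := by
  classical exact Finsupp.filter_apply_pos _ _ hx

theorem restrict_apply_of_not_mem {A : Set V} {n : ℕ} (c : (Fin n → V) →₀ 𝕜) {x : Fin n → V}
    (hx : ¬ ∀ i, x i ∈ A) : restrict 𝕜 A n c x = 0 := by
  classical exact Finsupp.filter_apply_neg _ _ hx

theorem restrict_single_of_mem {A : Set V} {n : ℕ} {x : Fin n → V} (hx : ∀ i, x i ∈ A) (a : 𝕜) :
    restrict 𝕜 A n (Finsupp.single x a) = Finsupp.single x a := by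
  classical exact Finsupp.filter_single_of_pos _ hx

theorem restrict_single_of_not_mem {A : Set V} {n : ℕ} {x : Fin n → V} (hx : ¬ ∀ i, x i ∈ A)
    (a : 𝕜) : restrict 𝕜 A n (Finsupp.single x a) = 0 := by
  classical exact Finsupp.filter_single_of_neg _ hx

/-- Every face of `K` lies inside `A` or outside of it. -/
def IsSeparated (K : PreAbstractSimplicialComplex V) (A : Set V) : Prop :=
  ∀ s ∈ K, ∀ x ∈ s, ∀ y ∈ s, x ∈ A → y ∈ A

/-- A tuple of `K` lies entirely in `A` or entirely outside, and so do its faces: each face keeps at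
least one vertex, which decides the side of the whole tuple. -/
theorem IsSeparated.boundary_restrict {K : PreAbstractSimplicialComplex V} {A : Set V}
    (hA : IsSeparated K A) {k : ℕ} {c : (Fin (k + 2) → V) →₀ 𝕜} (hc : c ∈ chains 𝕜 K (k + 1)) :
    boundary 𝕜 V k (restrict 𝕜 A _ c) = restrict 𝕜 A _ (boundary 𝕜 V k c) := by
  induction hc using chains_induction with
  | h0 => simp
  | hadd c c' _ _ h h' => simp only [map_add, h, h']
  | hs x a hx =>
    obtain ⟨s, hs, hxs⟩ := hx
    rw [boundary_single, map_sum]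
    by_cases h : ∀ i, x i ∈ A
    · rw [restrict_single_of_mem h, boundary_single]
      exact Finset.sum_congr rfl fun i _ => (restrict_single_of_mem (fun j => h _) _).symm
    · rw [restrict_single_of_not_mem h, map_zero]
      refine (Finset.sum_eq_zero fun i _ =>
        restrict_single_of_not_mem (fun h' => h fun j => ?_) _).symm
      exact hA s hs _ (hxs _) _ (hxs j) (h' 0)

theorem restrict_mem_chains {K L : PreAbstractSimplicialComplex V} {A : Set V}
    (h : ∀ s ∈ K, (∀ x ∈ s, x ∈ A) → s ∈ L) {k : ℕ} (hA : IsSeparated K A)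
    {c : (Fin (k + 1) → V) →₀ 𝕜} (hc : c ∈ chains 𝕜 K k) : restrict 𝕜 A _ c ∈ chains 𝕜 L k := by
  induction hc using chains_induction with
  | h0 => simp
  | hadd c c' _ _ h h' => rw [map_add]; exact add_mem h h'
  | hs x a hx =>
    obtain ⟨s, hs, hxs⟩ := hx
    by_cases hx : ∀ i, x i ∈ A
    · rw [restrict_single_of_mem hx]
      exact single_mem_chains _ ⟨s, h s hs fun y hy => hA s hs _ (hxs 0) _ hy (hx 0), hxs⟩
    · rw [restrict_single_of_not_mem hx]
      exact zero_mem _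

theorem restrict_mem_cycles {K L : PreAbstractSimplicialComplex V} {A : Set V}
    (h : ∀ s ∈ K, (∀ x ∈ s, x ∈ A) → s ∈ L) {k : ℕ} (hA : IsSeparated K A)
    {c : (Fin (k + 1) → V) →₀ 𝕜} (hc : c ∈ cycles 𝕜 K k) : restrict 𝕜 A _ c ∈ cycles 𝕜 L k := by
  cases k with
  | zero => exact restrict_mem_chains h hA hc
  | succ k =>
    refine ⟨restrict_mem_chains h hA hc.1, ?_⟩
    rw [SetLike.mem_coe, LinearMap.mem_ker, hA.boundary_restrict hc.1, LinearMap.mem_ker.1 hc.2,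
      map_zero]

theorem restrict_mem_boundaries {K L : PreAbstractSimplicialComplex V} {A : Set V}
    (h : ∀ s ∈ K, (∀ x ∈ s, x ∈ A) → s ∈ L) {k : ℕ} (hA : IsSeparated K A)
    {c : (Fin (k + 1) → V) →₀ 𝕜} (hc : c ∈ boundaries 𝕜 K k) :
    restrict 𝕜 A _ c ∈ boundaries 𝕜 L k := by
  obtain ⟨b, hb, rfl⟩ := hc
  exact ⟨_, restrict_mem_chains h hA hb, hA.boundary_restrict hb⟩

theorem restrict_eq_self {L : PreAbstractSimplicialComplex V} {A : Set V} {k : ℕ}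
    {c : (Fin (k + 1) → V) →₀ 𝕜} (hc : c ∈ chains 𝕜 L k) (h : ∀ s ∈ L, ∀ x ∈ s, x ∈ A) :
    restrict 𝕜 A _ c = c := by
  induction hc using chains_induction with
  | h0 => simp
  | hadd c c' _ _ h h' => rw [map_add, h, h']
  | hs x a hx =>
    obtain ⟨s, hs, hxs⟩ := hx
    exact restrict_single_of_mem (fun i => h s hs _ (hxs i)) a

theorem restrict_eq_zero {L : PreAbstractSimplicialComplex V} {A : Set V} {k : ℕ}
    {c : (Fin (k + 1) → V) →₀ 𝕜} (hc : c ∈ chains 𝕜 L k) (h : ∀ s ∈ L, ∀ x ∈ s, x ∉ A) :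
    restrict 𝕜 A _ c = 0 := by
  induction hc using chains_induction with
  | h0 => simp
  | hadd c c' _ _ h h' => rw [map_add, h, h', add_zero]
  | hs x a hx =>
    obtain ⟨s, hs, hxs⟩ := hx
    exact restrict_single_of_not_mem (fun h' => h s hs _ (hxs 0) (h' 0)) a

end Algebra

/-! ### Barycentric subdivision of affine chains

Chains are indexed here by the number of vertices, so that the complex is augmented. -/

section Subdivision

variable (𝕜 : Type*) [Field 𝕜] {V : Type*}

variable (V) in
/-- The augmented simplicial boundary operator on `n`-tuples. -/
def augBoundary (n : ℕ) : ((Fin (n + 1) → V) →₀ 𝕜) →ₗ[𝕜] ((Fin n → V) →₀ 𝕜) :=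
  ∑ i : Fin (n + 1),
    ((-1 : 𝕜) ^ (i : ℕ)) • Finsupp.lmapDomain 𝕜 𝕜 (fun x : Fin (n + 1) → V => x ∘ i.succAbove)

theorem augBoundary_succ (n : ℕ) : augBoundary 𝕜 V (n + 1) = boundary 𝕜 V n := rfl

/-- The cone over a chain with apex `b`. -/
def cone (b : V) (n : ℕ) : ((Fin n → V) →₀ 𝕜) →ₗ[𝕜] ((Fin (n + 1) → V) →₀ 𝕜) :=
  Finsupp.lmapDomain 𝕜 𝕜 (fun x => (Fin.cons b x : Fin (n + 1) → V))

variable {𝕜}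

theorem augBoundary_single {n : ℕ} (x : Fin (n + 1) → V) (a : 𝕜) :
    augBoundary 𝕜 V n (Finsupp.single x a) =
      ∑ i : Fin (n + 1), Finsupp.single (x ∘ i.succAbove) ((-1 : 𝕜) ^ (i : ℕ) * a) := by
  simp [augBoundary, Finsupp.mapDomain_single]

theorem cone_single (b : V) {n : ℕ} (x : Fin n → V) (a : 𝕜) :
    cone 𝕜 b n (Finsupp.single x a) = Finsupp.single (Fin.cons b x : Fin (n + 1) → V) a := by
  simp [cone, Finsupp.mapDomain_single]

theorem augBoundary_cone_zero (b : V) (c : (Fin 0 → V) →₀ 𝕜) :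
    augBoundary 𝕜 V 0 (cone 𝕜 b 0 c) = c := by
  induction c using Finsupp.induction_linear with
  | zero => simp
  | add c c' hc hc' => simp [hc, hc']
  | single x a =>
    rw [cone_single, augBoundary_single]
    simp only [Nat.reduceAdd, Finset.univ_unique, Finset.sum_singleton]
    congr 1
    simp

/-- Deleting the apex returns the base; deleting any other vertex gives the cone over a face of the
base, with the index shifted by one and hence the sign reversed. -/
theorem augBoundary_cone_succ (b : V) (n : ℕ) (c : (Fin (n + 1) → V) →₀ 𝕜) :
    augBoundary 𝕜 V (n + 1) (cone 𝕜 b (n + 1) c) = c - cone 𝕜 b n (augBoundary 𝕜 V n c) := by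
  induction c using Finsupp.induction_linear with
  | zero => simp
  | add c c' hc hc' => simp only [map_add, hc, hc']; abel
  | single x a =>
    rw [cone_single, augBoundary_single, Fin.sum_univ_succ, augBoundary_single, map_sum,
      sub_eq_add_neg, ← Finset.sum_neg_distrib]
    congr 1
    · simp
    · refine Finset.sum_congr rfl fun i _ => ?_
      rw [cone_single, ← Finsupp.single_neg]
      congr 1
      · funext j
        refine Fin.cases ?_ (fun j => ?_) j <;> simp
      · simp [pow_succ]

theorem augBoundary_augBoundary : ∀ (n : ℕ) (c : (Fin (n + 2) → V) →₀ 𝕜),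
    augBoundary 𝕜 V n (augBoundary 𝕜 V (n + 1) c) = 0
  | n + 1, c => boundary_boundary 𝕜 n c
  | 0, c => by
    induction c using Finsupp.induction_linear with
    | zero => simp
    | add c c' hc hc' => simp [hc, hc']
    | single x a =>
      rw [augBoundary_single, map_sum, Fin.sum_univ_two, augBoundary_single, augBoundary_single]
      simp only [Nat.reduceAdd, Finset.univ_unique, Finset.sum_singleton]
      rw [Subsingleton.elim ((x ∘ (0 : Fin 2).succAbove) ∘ (default : Fin 1).succAbove)
        ((x ∘ (1 : Fin 2).succAbove) ∘ (default : Fin 1).succAbove), ← Finsupp.single_add]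
      simp

theorem map_mem_supported {α β : Type*} (g : (α →₀ 𝕜) →ₗ[𝕜] (β →₀ 𝕜)) {s : Set α} {t : Set β}
    (h : ∀ x ∈ s, g (Finsupp.single x 1) ∈ Finsupp.supported 𝕜 𝕜 t) {c : α →₀ 𝕜}
    (hc : c ∈ Finsupp.supported 𝕜 𝕜 s) : g c ∈ Finsupp.supported 𝕜 𝕜 t := by
  rw [← Finsupp.sum_single c, Finsupp.sum, map_sum]
  refine Submodule.sum_mem _ fun x hx => ?_
  rw [← mul_one (c x), ← smul_eq_mul, ← Finsupp.smul_single, map_smul]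
  exact Submodule.smul_mem _ _ (h x ((Finsupp.mem_supported _ _).1 hc hx))

theorem augBoundary_mem_supported {n : ℕ} {s : Set (Fin (n + 1) → V)} {t : Set (Fin n → V)}
    (h : ∀ x ∈ s, ∀ i : Fin (n + 1), x ∘ i.succAbove ∈ t) {c : (Fin (n + 1) → V) →₀ 𝕜}
    (hc : c ∈ Finsupp.supported 𝕜 𝕜 s) : augBoundary 𝕜 V n c ∈ Finsupp.supported 𝕜 𝕜 t := by
  refine map_mem_supported _ (fun x hx => ?_) hc
  rw [augBoundary_single]
  exact Submodule.sum_mem _ fun i _ => Finsupp.single_mem_supported _ _ (h x hx i)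

theorem cone_mem_supported {n : ℕ} {s : Set (Fin n → V)} {t : Set (Fin (n + 1) → V)} {b : V}
    (h : ∀ x ∈ s, (Fin.cons b x : Fin (n + 1) → V) ∈ t) {c : (Fin n → V) →₀ 𝕜}
    (hc : c ∈ Finsupp.supported 𝕜 𝕜 s) : cone 𝕜 b n c ∈ Finsupp.supported 𝕜 𝕜 t := by
  refine map_mem_supported _ (fun x hx => ?_) hc
  rw [cone_single]
  exact Finsupp.single_mem_supported _ _ (h x hx)

variable [AddCommGroup V] [Module ℝ V]

/-- The barycentre of a tuple. -/
def tupleCenter {n : ℕ} (x : Fin n → V) : V := (n : ℝ)⁻¹ • ∑ i, x i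

variable (𝕜 V) in
/-- The barycentric subdivision operator. -/
def subdivision : (n : ℕ) → ((Fin n → V) →₀ 𝕜) →ₗ[𝕜] ((Fin n → V) →₀ 𝕜)
  | 0 => LinearMap.id
  | n + 1 => Finsupp.linearCombination 𝕜 fun x : Fin (n + 1) → V =>
      cone 𝕜 (tupleCenter x) n (subdivision n (augBoundary 𝕜 V n (Finsupp.single x 1)))

variable (𝕜 V) in
/-- The chain homotopy between the identity and the barycentric subdivision. -/
def subdivisionHomotopy : (n : ℕ) → ((Fin n → V) →₀ 𝕜) →ₗ[𝕜] ((Fin (n + 1) → V) →₀ 𝕜)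
  | 0 => 0
  | n + 1 => Finsupp.linearCombination 𝕜 fun x : Fin (n + 1) → V =>
      cone 𝕜 (tupleCenter x) (n + 1) (Finsupp.single x 1 -
        subdivisionHomotopy n (augBoundary 𝕜 V n (Finsupp.single x 1)))

theorem subdivision_single {n : ℕ} (x : Fin (n + 1) → V) :
    subdivision 𝕜 V (n + 1) (Finsupp.single x 1) =
      cone 𝕜 (tupleCenter x) n (subdivision 𝕜 V n (augBoundary 𝕜 V n (Finsupp.single x 1))) := by
  rw [subdivision, Finsupp.linearCombination_single, one_smul]

theorem subdivisionHomotopy_single {n : ℕ} (x : Fin (n + 1) → V) :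
    subdivisionHomotopy 𝕜 V (n + 1) (Finsupp.single x 1) =
      cone 𝕜 (tupleCenter x) (n + 1) (Finsupp.single x 1 -
        subdivisionHomotopy 𝕜 V n (augBoundary 𝕜 V n (Finsupp.single x 1))) := by
  rw [subdivisionHomotopy, Finsupp.linearCombination_single, one_smul]

theorem augBoundary_subdivision : ∀ (n : ℕ) (c : (Fin (n + 1) → V) →₀ 𝕜),
    augBoundary 𝕜 V n (subdivision 𝕜 V (n + 1) c) = subdivision 𝕜 V n (augBoundary 𝕜 V n c) := by
  intro n
  induction n with
  | zero =>
    intro c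
    rw [← LinearMap.comp_apply, ← LinearMap.comp_apply]
    congr 1
    refine Finsupp.lhom_ext' fun x => LinearMap.ext_ring ?_
    simp only [LinearMap.comp_apply, Finsupp.lsingle_apply]
    rw [subdivision_single, augBoundary_cone_zero]
  | succ n ih =>
    intro c
    rw [← LinearMap.comp_apply, ← LinearMap.comp_apply]
    congr 1
    refine Finsupp.lhom_ext' fun x => LinearMap.ext_ring ?_
    simp only [LinearMap.comp_apply, Finsupp.lsingle_apply]
    rw [subdivision_single, augBoundary_cone_succ, ih, augBoundary_augBoundary, map_zero, map_zero,
      sub_zero]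

/-- The recursion only uses the homotopy formula one degree down on boundaries, where its last term
drops out. That weaker form also makes sense for empty tuples, which start the induction. -/
theorem augBoundary_subdivisionHomotopy_succ_of_forall {n : ℕ}
    (h : ∀ c : (Fin (n + 1) → V) →₀ 𝕜, augBoundary 𝕜 V n (subdivisionHomotopy 𝕜 V n
      (augBoundary 𝕜 V n c)) = augBoundary 𝕜 V n c - subdivision 𝕜 V n (augBoundary 𝕜 V n c))
    (c : (Fin (n + 1) → V) →₀ 𝕜) :
    augBoundary 𝕜 V (n + 1) (subdivisionHomotopy 𝕜 V (n + 1) c) =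
      c - subdivision 𝕜 V (n + 1) c - subdivisionHomotopy 𝕜 V n (augBoundary 𝕜 V n c) := by
  have : (augBoundary 𝕜 V (n + 1) ∘ₗ subdivisionHomotopy 𝕜 V (n + 1)) =
      LinearMap.id - subdivision 𝕜 V (n + 1) -
        subdivisionHomotopy 𝕜 V n ∘ₗ augBoundary 𝕜 V n := by
    refine Finsupp.lhom_ext' fun x => LinearMap.ext_ring ?_
    simp only [LinearMap.comp_apply, Finsupp.lsingle_apply, LinearMap.sub_apply,
      LinearMap.id_apply]
    rw [subdivisionHomotopy_single, augBoundary_cone_succ, map_sub, h, subdivision_single,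
      sub_sub_cancel]
    abel
  exact LinearMap.congr_fun this c

theorem augBoundary_subdivisionHomotopy_augBoundary (n : ℕ) : ∀ c : (Fin (n + 1) → V) →₀ 𝕜,
    augBoundary 𝕜 V n (subdivisionHomotopy 𝕜 V n (augBoundary 𝕜 V n c)) =
      augBoundary 𝕜 V n c - subdivision 𝕜 V n (augBoundary 𝕜 V n c) := by
  induction n with
  | zero => exact fun c => by simp [subdivisionHomotopy, subdivision]
  | succ n ih =>
    intro c
    rw [augBoundary_subdivisionHomotopy_succ_of_forall ih, augBoundary_augBoundary, map_zero,
      sub_zero]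

theorem augBoundary_subdivisionHomotopy_succ (n : ℕ) (c : (Fin (n + 1) → V) →₀ 𝕜) :
    augBoundary 𝕜 V (n + 1) (subdivisionHomotopy 𝕜 V (n + 1) c) =
      c - subdivision 𝕜 V (n + 1) c - subdivisionHomotopy 𝕜 V n (augBoundary 𝕜 V n c) :=
  augBoundary_subdivisionHomotopy_succ_of_forall (augBoundary_subdivisionHomotopy_augBoundary n) c

theorem tupleCenter_mem {F : Set V} (hF : Convex ℝ F) {n : ℕ} {x : Fin (n + 1) → V}
    (hx : ∀ i, x i ∈ F) : tupleCenter x ∈ F := by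
  rw [tupleCenter, Finset.smul_sum]
  refine hF.sum_mem (fun _ _ => by positivity) ?_ fun i _ => hx i
  simp
  field_simp

theorem subdivisionHomotopy_mem_supported {F : Set V} (hF : Convex ℝ F) : ∀ (n : ℕ)
    {c : (Fin n → V) →₀ 𝕜}, c ∈ Finsupp.supported 𝕜 𝕜 {x | ∀ i, x i ∈ F} →
      subdivisionHomotopy 𝕜 V n c ∈ Finsupp.supported 𝕜 𝕜 {x | ∀ i, x i ∈ F}
  | 0, c, _ => by simp [subdivisionHomotopy]
  | n + 1, c, hc => by
    refine map_mem_supported _ (fun x hx => ?_) hc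
    rw [subdivisionHomotopy_single]
    refine cone_mem_supported (s := {x | ∀ i, x i ∈ F}) (fun y hy i => ?_)
      (sub_mem (Finsupp.single_mem_supported _ _ hx)
        (subdivisionHomotopy_mem_supported hF n (augBoundary_mem_supported
          (t := {x | ∀ i, x i ∈ F}) (fun y (hy : ∀ i, y i ∈ F) i j => hy _)
          (Finsupp.single_mem_supported _ _ hx))))
    refine Fin.cases ?_ (fun j => ?_) i
    · simpa using tupleCenter_mem hF hx
    · simpa using hy j

end Subdivision

/-! ### Mesh size of iterated barycentric subdivisions -/

section Mesh

variable {𝕜 : Type*} [Field 𝕜] {V : Type*} [NormedAddCommGroup V] [NormedSpace ℝ V]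

/-- The vector from `x j` to the barycentre is the average of `n + 1` differences, one of which is
zero. -/
theorem dist_tupleCenter_le {n : ℕ} {x : Fin (n + 1) → V} {δ : ℝ}
    (hx : ∀ i j, dist (x i) (x j) ≤ δ) (j : Fin (n + 1)) :
    dist (x j) (tupleCenter x) ≤ n / (n + 1) * δ := by
  have h1 : tupleCenter x - x j = ((n + 1 : ℕ) : ℝ)⁻¹ • ∑ i, (x i - x j) := by
    rw [Finset.sum_sub_distrib, smul_sub, tupleCenter]
    simp only [Finset.sum_const, Finset.card_univ, Fintype.card_fin]
    rw [← Nat.cast_smul_eq_nsmul ℝ, smul_smul, inv_mul_cancel₀ (by positivity), one_smul]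
  have h2 : ‖∑ i, (x i - x j)‖ ≤ n * δ := by
    rw [Fin.sum_univ_succAbove _ j, sub_self, zero_add]
    refine (norm_sum_le _ _).trans ?_
    calc ∑ i : Fin n, ‖x (j.succAbove i) - x j‖ ≤ ∑ _i : Fin n, δ :=
          Finset.sum_le_sum fun i _ => by rw [← dist_eq_norm]; exact hx _ _
      _ = n * δ := by simp
  rw [dist_comm, dist_eq_norm, h1, norm_smul, norm_inv, RCLike.norm_natCast]
  calc ((n + 1 : ℕ) : ℝ)⁻¹ * ‖∑ i, (x i - x j)‖ ≤ ((n + 1 : ℕ) : ℝ)⁻¹ * (n * δ) := by gcongr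
    _ = n / (n + 1) * δ := by push_cast; ring

/-- The barycentre is within `q * δ` of every vertex, hence of the whole convex hull, which contains
the vertices of the subdivided faces. A single `q` serves all smaller tuples met by the recursion.
-/
theorem subdivision_single_mem_supported {q δ : ℝ} (hq : 0 ≤ q) (hδ : 0 ≤ δ) : ∀ (n : ℕ),
    (∀ j < n, (j : ℝ) / (j + 1) ≤ q) → ∀ x : Fin n → V, (∀ i j, dist (x i) (x j) ≤ δ) →
      subdivision 𝕜 V n (Finsupp.single x 1) ∈ Finsupp.supported 𝕜 𝕜
        {y | (∀ i, y i ∈ convexHull ℝ (Set.range x)) ∧ ∀ i j, dist (y i) (y j) ≤ q * δ}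
  | 0, _, x, _ => Finsupp.single_mem_supported _ _ ⟨fun i => i.elim0, fun i => i.elim0⟩
  | n + 1, hn, x, hx => by
    rw [subdivision_single]
    have hmem : ∀ i, x i ∈ convexHull ℝ (Set.range x) := fun i =>
      subset_convexHull ℝ _ ⟨i, rfl⟩
    have hball : convexHull ℝ (Set.range x) ⊆ Metric.closedBall (tupleCenter x) (q * δ) := by
      refine convexHull_min ?_ (convex_closedBall _ _)
      rintro _ ⟨j, rfl⟩
      exact (dist_tupleCenter_le hx j).trans (by gcongr; exact hn n (Nat.lt_succ_self n))
    refine cone_mem_supported (s := {y | (∀ i, y i ∈ convexHull ℝ (Set.range x)) ∧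
      ∀ i j, dist (y i) (y j) ≤ q * δ}) ?_ ?_
    · rintro y ⟨hy, hy'⟩
      have h0 : tupleCenter x ∈ convexHull ℝ (Set.range x) :=
        tupleCenter_mem (convex_convexHull ℝ _) hmem
      refine ⟨fun i => ?_, fun i j => ?_⟩
      · refine Fin.cases ?_ (fun i => ?_) i
        · simpa using h0
        · simpa using hy i
      · refine Fin.cases (Fin.cases ?_ (fun j => ?_) j) (fun i => Fin.cases ?_ (fun j => ?_) j) i
        · simp; positivity
        · simpa [dist_comm] using hball (hy j)
        · simpa using hball (hy i)
        · simpa using hy' i j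
    · rw [augBoundary_single, map_sum]
      refine Submodule.sum_mem _ fun i _ => ?_
      rw [← smul_eq_mul (a := (-1 : 𝕜) ^ (i : ℕ)), ← Finsupp.smul_single, map_smul]
      refine Submodule.smul_mem _ _ ?_
      refine Finsupp.supported_mono ?_ (subdivision_single_mem_supported hq hδ n
        (fun j hj => hn j (by omega)) (x ∘ i.succAbove) fun a b => hx _ _)
      rintro y ⟨hy, hy'⟩
      exact ⟨fun a => convexHull_mono (Set.range_comp_subset_range _ _) (hy a), hy'⟩

variable (𝕜) in
/-- The chains of `n`-tuples of diameter at most `δ` all of which lie in one of the sets of the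
family `F`. -/
def fineChains {ι : Type*} (F : ι → Set V) (δ : ℝ) (n : ℕ) : Submodule 𝕜 ((Fin n → V) →₀ 𝕜) :=
  Finsupp.supported 𝕜 𝕜 {x | (∃ l, ∀ i, x i ∈ F l) ∧ ∀ i j, dist (x i) (x j) ≤ δ}

theorem subdivision_mem_fineChains {ι : Type*} {F : ι → Set V} (hF : ∀ l, Convex ℝ (F l)) {n : ℕ}
    {δ : ℝ} (hδ : 0 ≤ δ) {c : (Fin (n + 1) → V) →₀ 𝕜} (hc : c ∈ fineChains 𝕜 F δ (n + 1)) :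
    subdivision 𝕜 V (n + 1) c ∈ fineChains 𝕜 F (n / (n + 1) * δ) (n + 1) := by
  refine map_mem_supported _ ?_ hc
  rintro x ⟨⟨l, hl⟩, hx⟩
  refine Finsupp.supported_mono ?_ (subdivision_single_mem_supported (q := n / (n + 1))
    (by positivity) hδ (n + 1) (fun j hj => ?_) x hx)
  · rintro y ⟨hy, hy'⟩
    refine ⟨⟨l, fun i => convexHull_min ?_ (hF l) (hy i)⟩, hy'⟩
    rintro _ ⟨j, rfl⟩
    exact hl j
  · have : (j : ℝ) ≤ n := by exact_mod_cast Nat.lt_succ_iff.1 hj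
    rw [div_le_div_iff₀ (by positivity) (by positivity)]
    nlinarith

/-- A cycle can be subdivided into an arbitrarily fine one, without changing the value of a
cochain that is closed on each set of the family `F`. -/
theorem exists_fine_cycle {ι : Type*} {F : ι → Set V} (hF : ∀ l, Convex ℝ (F l)) {n : ℕ}
    (ψ : ((Fin (n + 1) → V) →₀ 𝕜) →ₗ[𝕜] 𝕜)
    (hψ : ∀ l, ∀ x : Fin (n + 2) → V, (∀ i, x i ∈ F l) →
      ψ (augBoundary 𝕜 V (n + 1) (Finsupp.single x 1)) = 0)
    {δ : ℝ} (hδ : 0 ≤ δ) {c : (Fin (n + 1) → V) →₀ 𝕜} (hc : c ∈ fineChains 𝕜 F δ (n + 1))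
    (hc0 : augBoundary 𝕜 V n c = 0) {η : ℝ} (hη : 0 < η) :
    ∃ c' ∈ fineChains 𝕜 F η (n + 1), augBoundary 𝕜 V n c' = 0 ∧ ψ c' = ψ c := by
  have hψ' : ∀ l, ∀ b ∈ Finsupp.supported 𝕜 𝕜 {x : Fin (n + 2) → V | ∀ i, x i ∈ F l},
      ψ (augBoundary 𝕜 V (n + 1) b) = 0 := by
    intro l b hb
    rw [← Finsupp.sum_single b, Finsupp.sum, map_sum, map_sum]
    refine Finset.sum_eq_zero fun x hx => ?_
    rw [← mul_one (b x), ← smul_eq_mul, ← Finsupp.smul_single, map_smul, map_smul,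
      hψ l x ((Finsupp.mem_supported _ _).1 hb hx), smul_zero]
  -- The homotopy keeps each tuple inside its convex set `F l`, where `ψ` is closed, so it does not
  -- affect the value of `ψ`.
  have hT : ∀ (δ : ℝ), ∀ c ∈ fineChains 𝕜 F δ (n + 1),
      ψ (augBoundary 𝕜 V (n + 1) (subdivisionHomotopy 𝕜 V (n + 1) c)) = 0 := by
    intro δ c hc
    rw [← Finsupp.sum_single c, Finsupp.sum, map_sum, map_sum, map_sum]
    refine Finset.sum_eq_zero fun x hx => ?_
    obtain ⟨⟨l, hl⟩, -⟩ := (Finsupp.mem_supported _ _).1 hc hx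
    exact hψ' l _ (subdivisionHomotopy_mem_supported (hF l) _
      (Finsupp.single_mem_supported _ _ hl))
  have hiter : ∀ N : ℕ, ∃ c' ∈ fineChains 𝕜 F ((n / (n + 1) : ℝ) ^ N * δ) (n + 1),
      augBoundary 𝕜 V n c' = 0 ∧ ψ c' = ψ c := by
    intro N
    induction N with
    | zero => exact ⟨c, by simpa using hc, hc0, rfl⟩
    | succ N ih =>
      obtain ⟨c', h1, h2, h3⟩ := ih
      refine ⟨subdivision 𝕜 V (n + 1) c', ?_, ?_, ?_⟩
      · have := subdivision_mem_fineChains hF (by positivity) h1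
        rwa [← mul_assoc, ← pow_succ'] at this
      · rw [augBoundary_subdivision, h2, map_zero]
      -- On a cycle the homotopy formula reads `∂ T c' = c' - sd c'`, and `ψ` kills the left side.
      · have h4 := hT _ _ h1
        rw [augBoundary_subdivisionHomotopy_succ, h2, map_zero, sub_zero, map_sub,
          sub_eq_zero] at h4
        rw [← h4, h3]
  have hlim : Tendsto (fun N : ℕ => (n / (n + 1) : ℝ) ^ N * δ) atTop (𝓝 0) := by
    rw [← zero_mul δ]
    refine (tendsto_pow_atTop_nhds_zero_of_lt_one (by positivity) ?_).mul_const δ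
    rw [div_lt_one (by positivity)]
    linarith
  obtain ⟨N, hN⟩ := (hlim.eventually (ge_mem_nhds hη)).exists
  obtain ⟨c', h1, h2⟩ := hiter N
  refine ⟨c', Finsupp.supported_mono ?_ h1, h2⟩
  rintro x ⟨hx, hx'⟩
  exact ⟨hx, fun i j => (hx' i j).trans hN⟩

end Mesh

/-! ### Existence of persistent cycles -/

section LabelCochain

variable (𝕜 : Type*) [Field 𝕜] {V : Type*}

/-- The alternating cochain that counts the tuples whose labels are all the nonzero ones. -/
def labelCochain {k : ℕ} (lab : V → Fin (k + 2)) : ((Fin (k + 1) → V) →₀ 𝕜) →ₗ[𝕜] 𝕜 :=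
  Finsupp.linearCombination 𝕜 fun x : Fin (k + 1) → V =>
    Matrix.det (Matrix.of fun a b : Fin (k + 1) => if lab (x a) = b.succ then (1 : 𝕜) else 0)

/-- The matrix of labels of a tuple, bordered by a column of ones. -/
def labelMatrix {k : ℕ} (lab : V → Fin (k + 2)) (x : Fin (k + 2) → V) :
    Matrix (Fin (k + 2)) (Fin (k + 2)) 𝕜 :=
  Matrix.of fun a => Fin.cons 1 fun b : Fin (k + 1) => if lab (x a) = b.succ then 1 else 0

variable {𝕜}

/-- The coboundary is the Laplace expansion along the column of ones. -/
theorem labelCochain_augBoundary {k : ℕ} (lab : V → Fin (k + 2)) (x : Fin (k + 2) → V) :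
    labelCochain 𝕜 lab (augBoundary 𝕜 V (k + 1) (Finsupp.single x 1)) =
      (labelMatrix 𝕜 lab x).det := by
  rw [augBoundary_single, map_sum, Matrix.det_succ_column_zero]
  refine Finset.sum_congr rfl fun i _ => ?_
  rw [labelCochain, Finsupp.linearCombination_single]
  simp only [mul_one, smul_eq_mul, labelMatrix, Matrix.of_apply, Fin.cons_zero]
  congr 2

/-- A repeated label gives two equal rows. By pigeonhole this applies to every tuple that misses a
label, so the cochain is closed wherever some label is absent. -/
theorem labelCochain_augBoundary_eq_zero {k : ℕ} {lab : V → Fin (k + 2)} {x : Fin (k + 2) → V}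
    (hx : ¬ Function.Injective fun i => lab (x i)) :
    labelCochain 𝕜 lab (augBoundary 𝕜 V (k + 1) (Finsupp.single x 1)) = 0 := by
  rw [labelCochain_augBoundary]
  simp only [Function.Injective, not_forall] at hx
  obtain ⟨i, j, hij, hne⟩ := hx
  refine Matrix.det_zero_of_row_eq hne ?_
  funext b
  simp only [labelMatrix, Matrix.of_apply, hij]

/-- For labels in order the bordered matrix is lower triangular with unit diagonal. -/
theorem labelCochain_augBoundary_eq_one {k : ℕ} {lab : V → Fin (k + 2)} {x : Fin (k + 2) → V}
    (hx : ∀ i, lab (x i) = i) :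
    labelCochain 𝕜 lab (augBoundary 𝕜 V (k + 1) (Finsupp.single x 1)) = 1 := by
  rw [labelCochain_augBoundary, Matrix.det_of_isLowerTriangular]
  · refine Finset.prod_eq_one fun i _ => ?_
    refine Fin.cases ?_ (fun j => ?_) i <;> simp [labelMatrix, hx]
  · intro i j hij
    have hij' : i < j := hij
    obtain ⟨j, rfl⟩ := Fin.exists_succ_eq.2 (Fin.ne_zero_of_lt hij')
    simp [labelMatrix, hx, hij'.ne]

end LabelCochain

/-! ### A Sperner argument for a finely subdivided simplex boundary -/

section Existence

variable {d k : ℕ} (h : k + 1 ≤ d)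

/-- The barycentric coordinates with respect to the origin and the first `k + 1` basis vectors. -/
def baryCoord (x : E d) : Fin (k + 2) → ℝ :=
  Fin.cons (1 - ∑ b : Fin (k + 1), x (Fin.castLE h b)) fun b => x (Fin.castLE h b)

/-- The origin and the first `k + 1` basis vectors. -/
def simplexVertex : Fin (k + 2) → E d :=
  Fin.cons 0 fun b => EuclideanSpace.single (Fin.castLE h b) 1

theorem baryCoord_simplexVertex (i j : Fin (k + 2)) :
    baryCoord h (simplexVertex h i) j = if j = i then 1 else 0 := by
  refine Fin.cases ?_ (fun i => ?_) i <;> refine Fin.cases ?_ (fun j => ?_) j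
  · simp [baryCoord, simplexVertex]
  · simp [baryCoord, simplexVertex]
  · simp [baryCoord, simplexVertex, (Fin.succ_ne_zero i).symm]
  · simp [baryCoord, simplexVertex]

theorem sum_baryCoord (x : E d) : ∑ i, baryCoord h x i = 1 := by
  simp [baryCoord, Fin.sum_univ_succ]

/-- Some coordinate is at least the mean. Its index serves as a Sperner label, and the positive
threshold prevents label `l` not only on the facet where coordinate `l` vanishes but also near it.
-/
theorem exists_le_baryCoord (x : E d) : ∃ i, 1 / (k + 2 : ℝ) ≤ baryCoord h x i := by
  by_contra! hlt
  have := Finset.sum_lt_sum_of_nonempty Finset.univ_nonempty fun i _ => hlt i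
  rw [sum_baryCoord] at this
  simp at this
  field_simp at this
  exact lt_irrefl _ this

theorem abs_apply_sub_le (x y : E d) (i : Fin d) : |x i - y i| ≤ dist x y := by
  have := PiLp.norm_apply_le (x - y) i
  rwa [← dist_eq_norm] at this

theorem abs_baryCoord_sub_le (x y : E d) (i : Fin (k + 2)) :
    |baryCoord h x i - baryCoord h y i| ≤ (k + 1) * dist x y := by
  refine Fin.cases ?_ (fun i => ?_) i
  · simp only [baryCoord, Fin.cons_zero]
    rw [abs_sub_comm, sub_sub_sub_cancel_left, ← Finset.sum_sub_distrib]
    refine (Finset.abs_sum_le_sum_abs _ _).trans ?_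
    calc _ ≤ ∑ _b : Fin (k + 1), dist x y := Finset.sum_le_sum fun b _ => abs_apply_sub_le _ _ _
      _ = _ := by simp
  · simp only [baryCoord, Fin.cons_succ]
    refine (abs_apply_sub_le _ _ _).trans ?_
    have : (0 : ℝ) ≤ k * dist x y := by positivity
    linarith

theorem convex_baryCoord_eq_zero (i : Fin (k + 2)) : Convex ℝ {x : E d | baryCoord h x i = 0} := by
  intro x hx y hy a b _ _ hab
  simp only [Set.mem_ofPred_eq] at hx hy ⊢
  have : baryCoord h (a • x + b • y) i = a * baryCoord h x i + b * baryCoord h y i := by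
    refine Fin.cases ?_ (fun i => ?_) i
    · simp only [baryCoord, Fin.cons_zero, PiLp.add_apply, PiLp.smul_apply, smul_eq_mul,
        Finset.sum_add_distrib, ← Finset.mul_sum]
      linear_combination (-1 : ℝ) * hab
    · simp [baryCoord]
  rw [this, hx, hy, mul_zero, mul_zero, add_zero]

theorem dist_le_of_mem_cech {P : Finset (E d)} {r : ℝ} {s : Finset (E d)} (hs : s ∈ cech P r)
    {x y : E d} (hx : x ∈ s) (hy : y ∈ s) : dist x y ≤ 2 * r := by
  obtain ⟨z, hz⟩ := hs.2.2
  simp only [Set.mem_iInter, Metric.mem_closedBall] at hz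
  have h1 := hz x hx
  have h2 := hz y hy
  have := dist_triangle_left x y z
  linarith

variable (𝕜 : Type*) [Field 𝕜]

/-- The label cochain `ψ` takes the value 1 on the boundary of the simplex and on its fine
subdivision `γ`. A Čech face of small radius stays close to some facet, so it misses a label and `ψ`
vanishes on its boundary; hence `γ` bounds nothing at radius `ϑ * η`. -/
theorem persistentCycleSizes_nonempty {d k : ℕ} (h : k + 1 ≤ d) (hk : 1 ≤ k) {ϑ : ℝ} (hϑ : 1 ≤ ϑ) :
    (persistentCycleSizes 𝕜 d k ϑ).Nonempty := by
  classical
  choose lab hlab using exists_le_baryCoord h (d := d) (k := k)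
  let F : Fin (k + 2) → Set (E d) := fun l => {x | baryCoord h x l = 0}
  have hlabF : ∀ l, ∀ x ∈ F l, lab x ≠ l := by
    rintro l x hx rfl
    have h1 := hlab x
    rw [show baryCoord h x (lab x) = 0 from hx] at h1
    have : (0 : ℝ) < 1 / (k + 2) := by positivity
    linarith
  let ψ := labelCochain 𝕜 lab
  have hψ : ∀ l, ∀ x : Fin (k + 2) → E d, (∀ i, x i ∈ F l) →
      ψ (augBoundary 𝕜 (E d) (k + 1) (Finsupp.single x 1)) = 0 := by
    intro l x hx
    refine labelCochain_augBoundary_eq_zero fun hinj => ?_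
    obtain ⟨i, hi⟩ := (Finite.injective_iff_surjective.1 hinj) l
    exact hlabF l _ (hx i) hi
  let v := simplexVertex h
  have hlabv : ∀ i, lab (v i) = i := by
    intro i
    by_contra hne
    have h1 := hlab (v i)
    rw [baryCoord_simplexVertex, if_neg hne] at h1
    have : (0 : ℝ) < 1 / (k + 2) := by positivity
    linarith
  obtain ⟨δ, hδ0, hδ⟩ : ∃ δ : ℝ, 0 ≤ δ ∧ ∀ i j, dist (v i) (v j) ≤ δ :=
    ⟨∑ i, ∑ j, dist (v i) (v j), by positivity, fun i j =>
      (Finset.single_le_sum (f := fun j => dist (v i) (v j)) (fun _ _ => dist_nonneg)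
        (Finset.mem_univ j)).trans (Finset.single_le_sum
        (f := fun i => ∑ j, dist (v i) (v j)) (fun _ _ => by positivity) (Finset.mem_univ i))⟩
  -- Faces at radius `ϑ * η` have diameter at most `2 * (ϑ * η)`, and barycentric coordinates are
  -- `(k + 1)`-Lipschitz. This `η` makes them vary by less than the label threshold over a face.
  obtain ⟨η, hη, hη'⟩ : ∃ η : ℝ, 0 < η ∧ (k + 1) * (2 * (ϑ * η)) < 1 / (k + 2) := by
    refine ⟨1 / (k + 2) / (4 * (k + 1) * ϑ), by positivity, ?_⟩
    have : (0 : ℝ) < 1 / (k + 2) := by positivity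
    have hne : ϑ ≠ 0 := by positivity
    have : (k + 1 : ℝ) * (2 * (ϑ * (1 / (k + 2) / (4 * (k + 1) * ϑ)))) = 1 / (k + 2) / 2 := by
      field_simp
      ring
    rw [this]
    linarith
  have hγ₀ : augBoundary 𝕜 (E d) (k + 1) (Finsupp.single v 1) ∈ fineChains 𝕜 F δ (k + 1) := by
    rw [augBoundary_single]
    refine Submodule.sum_mem _ fun l _ => Finsupp.single_mem_supported _ _ ⟨⟨l, fun i => ?_⟩,
      fun i j => hδ _ _⟩
    have := baryCoord_simplexVertex h (l.succAbove i) l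
    rwa [if_neg (Fin.succAbove_ne _ _).symm] at this
  obtain ⟨γ, hγ, hγ0, hψγ⟩ := exists_fine_cycle (convex_baryCoord_eq_zero h) ψ hψ hδ0 hγ₀
    (augBoundary_augBoundary _ _) hη
  have hψγ' : ψ γ = 1 := hψγ.trans (labelCochain_augBoundary_eq_one hlabv)
  let P : Finset (E d) := γ.support.biUnion fun x => Finset.univ.image x
  refine ⟨P.card, P, ⟨η, hη, γ, ?_, ?_⟩, rfl⟩
  -- Since `k ≥ 1`, the augmented boundary killing `γ` is the ordinary one.
  · obtain ⟨k, rfl⟩ : ∃ k', k = k' + 1 := ⟨k - 1, by omega⟩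
    refine ⟨?_, hγ0⟩
    refine (Finsupp.mem_supported _ _).2 fun x hx => ⟨Finset.univ.image x, ⟨?_, ?_, ?_⟩, ?_⟩
    · exact Finset.univ_nonempty.image _
    · exact Finset.subset_biUnion_of_mem (fun x : Fin (k + 1 + 1) → E d => Finset.univ.image x) hx
    · refine ⟨x 0, ?_⟩
      simp only [Set.mem_iInter, Metric.mem_closedBall, Finset.mem_image, Finset.mem_univ, true_and]
      rintro _ ⟨j, rfl⟩
      exact ((Finsupp.mem_supported _ _).1 hγ hx).2 _ _
    · simp
  · rintro ⟨b, hb, hbγ⟩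
    have hzero : ψ (boundary 𝕜 (E d) k b) = 0 := by
      rw [← Finsupp.sum_single b, Finsupp.sum, map_sum, map_sum]
      refine Finset.sum_eq_zero fun x hx => ?_
      rw [← mul_one (b x), ← smul_eq_mul, ← Finsupp.smul_single, map_smul, map_smul,
        ← augBoundary_succ, labelCochain_augBoundary_eq_zero, smul_zero]
      -- If all labels occurred, one vertex would have label `l`, where `l` is a facet containing `x
      -- 0`; its `l`-th coordinate would then be too large for its distance to `x 0`.
      intro hinj
      obtain ⟨s, hs, hxs⟩ := (Finsupp.mem_supported _ _).1 hb hx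
      obtain ⟨y, hy, hxy⟩ := Finset.mem_biUnion.1 (hs.2.1 (hxs 0))
      obtain ⟨i, -, hi⟩ := Finset.mem_image.1 hxy
      obtain ⟨⟨l, hl⟩, -⟩ := (Finsupp.mem_supported _ _).1 hγ hy
      obtain ⟨j, hj⟩ := (Finite.injective_iff_surjective.1 hinj) l
      have h1 : baryCoord h (x 0) l = 0 := hi ▸ hl i
      have h2 := hlab (x j)
      rw [show lab (x j) = l from hj] at h2
      have h3 := abs_baryCoord_sub_le h (x j) (x 0) l
      have h4 := dist_le_of_mem_cech hs (hxs j) (hxs 0)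
      rw [h1, sub_zero] at h3
      have h5 := le_abs_self (baryCoord h (x j) l)
      have h6 : (k + 1 : ℝ) * dist (x j) (x 0) ≤ (k + 1) * (2 * (ϑ * η)) := by gcongr
      linarith
    rw [hbγ, hψγ'] at hzero
    exact one_ne_zero hzero

end Existence

/-! ### Deterministic bounds on persistent Betti numbers -/

section Deterministic

variable {𝕜 : Type*} [Field 𝕜] {d k : ℕ}

theorem cech_mono_left {C P : Finset (E d)} (h : C ⊆ P) (r : ℝ) : cech C r ≤ cech P r :=
  fun _ ⟨hne, hC, hQ⟩ => ⟨hne, hC.trans h, hQ⟩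

theorem mem_cech_of_subset {C P : Finset (E d)} {r : ℝ} {s : Finset (E d)} (hs : s ∈ cech P r)
    (h : s ⊆ C) : s ∈ cech C r :=
  ⟨hs.1, h, hs.2.2⟩

/-- Two points are linked if they are points of `P` at distance at most `2 r`. -/
def Linked (P : Finset (E d)) (r : ℝ) (x y : E d) : Prop :=
  x ∈ P ∧ y ∈ P ∧ dist x y ≤ 2 * r

/-- The set of points that can be joined to `x` by a chain of linked points. -/
def component (P : Finset (E d)) (r : ℝ) (x : E d) : Set (E d) :=
  {y | Relation.ReflTransGen (Linked P r) x y}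

theorem Linked.symm {P : Finset (E d)} {r : ℝ} {x y : E d} (h : Linked P r x y) :
    Linked P r y x :=
  ⟨h.2.1, h.1, by rw [dist_comm]; exact h.2.2⟩

theorem component_eq_of_mem {P : Finset (E d)} {r : ℝ} {x y : E d} (h : y ∈ component P r x) :
    component P r y = component P r x := by
  have hsymm : Relation.ReflTransGen (Linked P r) y x := by
    have h' : Relation.ReflTransGen (Linked P r) x y := h
    exact Relation.ReflTransGen.mono (fun a b hab => Linked.symm hab) _ _ h'.swap
  ext z
  exact ⟨fun hz => Relation.ReflTransGen.trans h hz, fun hz => hsymm.trans hz⟩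

theorem linked_of_mem_cech {P : Finset (E d)} {r : ℝ} {s : Finset (E d)} (hs : s ∈ cech P r)
    {x y : E d} (hx : x ∈ s) (hy : y ∈ s) : Linked P r x y :=
  ⟨hs.2.1 hx, hs.2.1 hy, dist_le_of_mem_cech hs hx hy⟩

theorem isSeparated_component (P : Finset (E d)) (r : ℝ) (x : E d) :
    IsSeparated (cech P r) (component P r x) :=
  fun _ hs _ hy _ hz h => Relation.ReflTransGen.tail h (linked_of_mem_cech hs hy hz)

open Classical in
/-- A large component has many points close to each of its points. -/
theorem le_card_filter_dist {P : Finset (E d)} {r : ℝ} (hr : 0 < r) {x : E d} (hx : x ∈ P) {m : ℕ}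
    (hm : m ≤ (P.filter (· ∈ component P r x)).card) :
    m ≤ (P.filter fun y => dist x y ≤ 2 * r * m).card := by
  let N : ℕ → Finset (E d) := fun j => P.filter fun y => dist x y ≤ 2 * r * j
  have hmono : ∀ j, N j ⊆ N (j + 1) := by
    intro j y hy
    simp only [N, Finset.mem_filter] at hy ⊢
    refine ⟨hy.1, hy.2.trans ?_⟩
    push_cast
    nlinarith
  have hx0 : ∀ j, x ∈ N j := fun j => by
    simp only [N, Finset.mem_filter, dist_self]
    exact ⟨hx, by positivity⟩
  -- The neighbourhoods `N j` either gain a point at each step or stabilise; a stable one is closed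
  -- under linking and so contains the whole component.
  have key : ∀ j, P.filter (· ∈ component P r x) ⊆ N j ∨ j + 1 ≤ (N j).card := by
    intro j
    induction j with
    | zero => exact Or.inr (Finset.card_pos.2 ⟨x, hx0 0⟩)
    | succ j ih =>
      rcases ih with ih | ih
      · exact Or.inl (ih.trans (hmono j))
      · by_cases hc : j + 1 + 1 ≤ (N (j + 1)).card
        · exact Or.inr hc
        · have heq : N j = N (j + 1) := Finset.eq_of_subset_of_card_le (hmono j) (by omega)
          left
          intro y hy
          rw [← heq]
          have hy' : Relation.ReflTransGen (Linked P r) x y := (Finset.mem_filter.1 hy).2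
          clear hy
          induction hy' with
          | refl => exact hx0 j
          | tail _ hbc ihb =>
            rw [heq]
            simp only [N, Finset.mem_filter] at ihb ⊢
            refine ⟨hbc.2.1, (dist_triangle _ _ _).trans ((add_le_add ihb.2 hbc.2.2).trans ?_)⟩
            push_cast
            linarith
  rcases key m with h | h
  · exact hm.trans (Finset.card_le_card h)
  · exact (Nat.le_succ m).trans h

theorem cycles_le_boundaries_of_card_lt {ϑ : ℝ} {C : Finset (E d)}
    (hC : C.card < minCycleSize 𝕜 d k ϑ) {r : ℝ} (hr : 0 < r) :
    cycles 𝕜 (cech C r) k ≤ boundaries 𝕜 (cech C (ϑ * r)) k := by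
  intro z hz
  by_contra hb
  exact Nat.notMem_of_lt_sInf hC ⟨C, ⟨r, hr, z, hz, hb⟩, rfl⟩

variable (𝕜) in
open Classical in
/-- The persistent rank is at most the number of tuples that have at least `minCycleSize` many
points around them. -/
theorem persistentRank_cech_le {ϑ r : ℝ} (hr : 0 < r) (P : Finset (E d)) :
    persistentRank 𝕜 (cech P r) (cech P (ϑ * r)) k ≤
      ((Fintype.piFinset fun _ : Fin (k + 1) => P).filter fun x =>
        (∀ i, dist (x 0) (x i) ≤ 2 * r) ∧ minCycleSize 𝕜 d k ϑ ≤
          (P.filter fun y => dist (x 0) y ≤ 2 * r * minCycleSize 𝕜 d k ϑ).card).card := by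
  set m := minCycleSize 𝕜 d k ϑ
  refine finrank_map_mkQ_le_card _ _ _ fun z hz hS => ?_
  have hzc := (Finsupp.mem_supported _ _).1 (cycles_le_chains _ _ hz)
  -- A face at radius `r` lies in one component, so the cycle is the sum of its restrictions to the
  -- components.
  have hz_sum : z = ∑ C ∈ P.image (component P r), restrict 𝕜 C _ z := by
    ext x
    rw [Finsupp.finsetSum_apply]
    by_cases hx : z x = 0
    · rw [hx]
      refine (Finset.sum_eq_zero fun C _ => ?_).symm
      by_cases hxC : ∀ i, x i ∈ C
      · rw [restrict_apply_of_mem _ hxC, hx]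
      · exact restrict_apply_of_not_mem _ hxC
    · obtain ⟨s, hs, hxs⟩ := hzc (Finsupp.mem_support_iff.2 hx)
      rw [Finset.sum_eq_single (component P r (x 0)), restrict_apply_of_mem]
      · exact fun i => Relation.ReflTransGen.single (linked_of_mem_cech hs (hxs 0) (hxs i))
      · intro C hC hne
        obtain ⟨y, -, rfl⟩ := Finset.mem_image.1 hC
        refine restrict_apply_of_not_mem _ fun h => hne ?_
        exact (component_eq_of_mem (h 0)).symm
      · exact fun h => absurd (Finset.mem_image_of_mem _ (hs.2.1 (hxs 0))) h
  rw [hz_sum]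
  refine Submodule.sum_mem _ fun C hC => ?_
  obtain ⟨y, hy, rfl⟩ := Finset.mem_image.1 hC
  -- A component with fewer than `m` points fills its part of the cycle by minimality. In a larger
  -- one every tuple of the support is among those on which `z` was assumed to vanish.
  by_cases hcard : (P.filter (· ∈ component P r y)).card < m
  · refine boundaries_mono (cech_mono_left (Finset.filter_subset _ P) _) k
      (cycles_le_boundaries_of_card_lt hcard hr ?_)
    exact restrict_mem_cycles (fun s hs h => mem_cech_of_subset hs fun x hx =>
      Finset.mem_filter.2 ⟨hs.2.1 hx, h x hx⟩) (isSeparated_component P r y) hz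
  · have : restrict 𝕜 (component P r y) (k + 1) z = 0 := by
      ext x
      rw [Finsupp.zero_apply]
      by_cases hxC : ∀ i, x i ∈ component P r y
      · rw [restrict_apply_of_mem _ hxC]
        by_contra hx
        obtain ⟨s, hs, hxs⟩ := hzc (Finsupp.mem_support_iff.2 hx)
        refine hx (hS x (Finset.mem_filter.2 ⟨Fintype.mem_piFinset.2 fun i => hs.2.1 (hxs i),
          fun i => dist_le_of_mem_cech hs (hxs 0) (hxs i), le_card_filter_dist hr
            (hs.2.1 (hxs 0)) ?_⟩))
        rw [component_eq_of_mem (hxC 0)]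
        exact not_lt.1 hcard
      · exact restrict_apply_of_not_mem _ hxC
    rw [this]
    exact zero_mem _

/-- If `Q` were a face at all radii above `r`, the decreasing compact intersections of balls would
have a common point, which witnesses `Q` at radius `r`. -/
theorem eventually_mem_cech_imp (P Q : Finset (E d)) (r : ℝ) :
    ∀ᶠ ε in 𝓝[>] (0 : ℝ), Q ∈ cech P (r + ε) → Q ∈ cech P r := by
  by_cases hQ : Q ∈ cech P r
  · exact Eventually.of_forall fun _ _ => hQ
  by_contra hev
  have hall : ∀ ε > 0, Q ∈ cech P (r + ε) := by
    intro ε hε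
    by_contra hne
    refine hev ?_
    filter_upwards [Ioc_mem_nhdsGT hε] with δ hδ h
    exact absurd (cech_mono P (by linarith [hδ.2]) h) hne
  have h1 := hall 1 one_pos
  refine hQ ⟨h1.1, h1.2.1, ?_⟩
  obtain ⟨x₀, hx₀⟩ := h1.1
  let t : ℕ → Set (E d) := fun n => ⋂ x ∈ Q, Metric.closedBall x (r + 1 / (n + 1))
  have hcl : ∀ n, IsClosed (t n) := fun n => isClosed_biInter fun _ _ => Metric.isClosed_closedBall
  have hne : (⋂ n, t n).Nonempty := by
    refine IsCompact.nonempty_iInter_of_sequence_nonempty_isCompact_isClosed t (fun n => ?_)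
      (fun n => (hall _ (by positivity)).2.2) ?_ hcl
    · refine Set.iInter₂_mono fun _ _ => Metric.closedBall_subset_closedBall ?_
      gcongr
      linarith
    · exact (isCompact_closedBall x₀ _).of_isClosed_subset (hcl 0) (Set.biInter_subset_of_mem hx₀)
  obtain ⟨z, hz⟩ := hne
  simp only [t, Set.mem_iInter, Metric.mem_closedBall] at hz
  refine ⟨z, ?_⟩
  simp only [Set.mem_iInter, Metric.mem_closedBall]
  intro x hx
  refine ge_of_tendsto' (f := fun n : ℕ => r + 1 / ((n : ℝ) + 1)) (x := atTop) ?_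
    fun n => hz n x hx
  simpa using tendsto_one_div_add_atTop_nhds_zero_nat.const_add r

/-- The Čech complex is right continuous in the radius. -/
theorem eventually_cech_le (P : Finset (E d)) (r : ℝ) :
    ∀ᶠ ε in 𝓝[>] (0 : ℝ), cech P (r + ε) ≤ cech P r := by
  have := (Filter.eventually_all_finset P.powerset).2 fun Q _ => eventually_mem_cech_imp P Q r
  filter_upwards [this] with ε hε Q hQ
  exact hε Q (Finset.mem_powerset.2 hQ.2.1) hQ

/-- A persistent cycle with a given number of points persists in all small perturbations of all
homothetic copies of its vertex set. -/
theorem exists_stable_configuration {ϑ : ℝ} (hϑ : 1 ≤ ϑ) {m : ℕ}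
    (hm : m ∈ persistentCycleSizes 𝕜 d k ϑ) :
    ∃ (y : Fin m → E d) (ε : ℝ), 0 < ε ∧ (∀ i j, i ≠ j → 2 * ε < dist (y i) (y j)) ∧
      ∀ r > 0, ∀ (p : E d) (c : Fin m → E d), (∀ i, dist (c i) (p + r • y i) ≤ r * ε) →
        ∀ C : Finset (E d), (∀ x, x ∈ C ↔ ∃ i, c i = x) →
          ∃ γ ∈ cycles 𝕜 (cech C r) k, γ ∉ boundaries 𝕜 (cech C (ϑ * r)) k := by
  obtain ⟨P, ⟨r₀, hr₀, γ, hγ, hγ'⟩, rfl⟩ := hm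
  let y : Fin P.card → E d := fun i => P.equivFin.symm i
  have hyinj : Function.Injective y := fun i j hij => P.equivFin.symm.injective (Subtype.ext hij)
  have hyP : ∀ i, y i ∈ P := fun i => (P.equivFin.symm i).2
  have hysurj : ∀ x ∈ P, ∃ i, y i = x := fun x hx => ⟨P.equivFin ⟨x, hx⟩, by simp [y]⟩
  -- Passing to a perturbed copy enlarges `r₀` to `r₀ + ε`; coming back at the persistent scale
  -- enlarges `ϑ * (r₀ + ε)` by another `ε`. Right continuity absorbs both, and the separation keeps
  -- perturbed points distinct. Dividing by `r₀ + ε` then makes 1 the reference radius.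
  obtain ⟨ε, hε, hεdist, hεcech⟩ : ∃ ε : ℝ, 0 < ε ∧ (∀ i j, i ≠ j → 2 * ε < dist (y i) (y j)) ∧
      cech P (ϑ * (r₀ + ε) + ε) ≤ cech P (ϑ * r₀) := by
    have h1 : ∀ᶠ ε in 𝓝[>] (0 : ℝ), 0 < ε := self_mem_nhdsWithin
    have h2 : ∀ᶠ ε in 𝓝[>] (0 : ℝ), ∀ i j, i ≠ j → 2 * ε < dist (y i) (y j) := by
      refine Filter.eventually_all.2 fun i => Filter.eventually_all.2 fun j => ?_
      by_cases hij : i = j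
      · exact Eventually.of_forall fun _ h => absurd hij h
      · have hpos : 0 < dist (y i) (y j) := dist_pos.2 (hyinj.ne hij)
        filter_upwards [Ioo_mem_nhdsGT (half_pos hpos)] with ε hε _
        linarith [hε.2]
    have h3 : Tendsto (fun ε : ℝ => ϑ * ε + ε) (𝓝[>] 0) (𝓝[>] 0) := by
      refine tendsto_nhdsWithin_iff.2 ⟨?_, ?_⟩
      · have : Tendsto (fun ε : ℝ => ϑ * ε + ε) (𝓝 0) (𝓝 (ϑ * 0 + 0)) :=
          Continuous.tendsto (by fun_prop) 0
        simp only [mul_zero, add_zero] at this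
        exact this.mono_left nhdsWithin_le_nhds
      · filter_upwards [h1] with ε hε
        exact Set.mem_Ioi.2 (by positivity)
    obtain ⟨ε, h1, h2, h3⟩ :=
      (h1.and (h2.and (h3.eventually (eventually_cech_le P (ϑ * r₀))))).exists
    refine ⟨ε, h1, h2, ?_⟩
    rwa [show ϑ * (r₀ + ε) + ε = ϑ * r₀ + (ϑ * ε + ε) by ring]
  have hρ : 0 < r₀ + ε := by positivity
  refine ⟨fun i => (r₀ + ε)⁻¹ • y i, ε / (r₀ + ε), by positivity, fun i j hij => ?_,
    fun r hr p c hc C hC => ?_⟩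
  · rw [dist_smul₀, norm_inv, Real.norm_of_nonneg hρ.le, inv_mul_eq_div, ← mul_div_assoc]
    gcongr
    exact hεdist i j hij
  obtain ⟨t, ht, rfl⟩ : ∃ t, 0 < t ∧ r = t * (r₀ + ε) :=
    ⟨r / (r₀ + ε), by positivity, by field_simp⟩
  have hc' : ∀ i, dist (c i) (p + t • y i) ≤ t * ε := by
    intro i
    have := hc i
    rw [smul_smul, mul_assoc t, mul_inv_cancel₀ hρ.ne', mul_one, mul_assoc,
      mul_div_cancel₀ _ hρ.ne'] at this
    exact this
  have hcinj : Function.Injective c := by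
    intro i j hij
    by_contra hne
    have h1 := hc' i
    have h2 := hc' j
    rw [hij] at h1
    have h3 := dist_triangle_left (p + t • y i) (p + t • y j) (c j)
    rw [dist_add_left, dist_smul₀, Real.norm_of_nonneg ht.le] at h3
    have h4 := mul_lt_mul_of_pos_left (hεdist i j hne) ht
    linarith
  let f : E d → E d := Function.extend y c id
  let g : E d → E d := Function.extend c y id
  have hfy : ∀ i, f (y i) = c i := fun i => hyinj.extend_apply _ _ i
  have hgc : ∀ i, g (c i) = y i := fun i => hcinj.extend_apply _ _ i
  have hf : IsSimplicial (cech P r₀) (cech C (t * (r₀ + ε))) f := by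
    classical
    rintro s ⟨hne, hsP, z, hz⟩
    refine ⟨s.image f, ⟨hne.image _, ?_, p + t • z, ?_⟩, fun x hx => Finset.mem_image_of_mem _ hx⟩
    · intro x hx
      obtain ⟨x, hxs, rfl⟩ := Finset.mem_image.1 hx
      obtain ⟨i, rfl⟩ := hysurj x (hsP hxs)
      exact (hC _).2 ⟨i, (hfy i).symm⟩
    · simp only [Set.mem_iInter, Metric.mem_closedBall, Finset.mem_image] at hz ⊢
      rintro _ ⟨x, hx, rfl⟩
      obtain ⟨i, rfl⟩ := hysurj x (hsP hx)
      rw [hfy]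
      have h1 := hc' i
      have h2 := hz _ hx
      have h3 := dist_triangle_right (p + t • z) (c i) (p + t • y i)
      rw [dist_add_left, dist_smul₀, Real.norm_of_nonneg ht.le] at h3
      have h4 := mul_le_mul_of_nonneg_left h2 ht.le
      linarith
  have hg : IsSimplicial (cech C (ϑ * (t * (r₀ + ε)))) (cech P (ϑ * r₀)) g := by
    classical
    rintro s ⟨hne, hsC, z, hz⟩
    refine ⟨s.image g, hεcech ⟨hne.image _, ?_, t⁻¹ • (z - p), ?_⟩,
      fun x hx => Finset.mem_image_of_mem _ hx⟩
    · intro x hx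
      obtain ⟨x, hxs, rfl⟩ := Finset.mem_image.1 hx
      obtain ⟨i, rfl⟩ := (hC x).1 (hsC hxs)
      rw [hgc]
      exact hyP i
    · simp only [Set.mem_iInter, Metric.mem_closedBall, Finset.mem_image] at hz ⊢
      rintro _ ⟨x, hx, rfl⟩
      obtain ⟨i, rfl⟩ := (hC x).1 (hsC hx)
      rw [hgc]
      have h1 := hc' i
      have h2 := hz _ hx
      have h3 := dist_triangle z (c i) (p + t • y i)
      have h4 : dist (t⁻¹ • (z - p)) (y i) = t⁻¹ * dist z (p + t • y i) := by
        rw [dist_eq_norm, dist_eq_norm, ← Real.norm_of_nonneg (inv_pos.2 ht).le, ← norm_smul,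
          Real.norm_of_nonneg (inv_pos.2 ht).le, ← sub_sub, smul_sub t⁻¹ (z - p), smul_smul,
          inv_mul_cancel₀ ht.ne', one_smul]
      rw [h4, inv_mul_le_iff₀ ht]
      linarith
  -- If the transported cycle bounded in the copy, pushing the filling back along `g` would fill `γ`
  -- in `P`.
  refine ⟨_, hf.vertexMap_mem_cycles hγ, fun hb => hγ' ?_⟩
  have := hg.vertexMap_mem_boundaries hb
  rwa [vertexMap_vertexMap_of_mem_chains _ (cycles_le_chains _ _ hγ)] at this
  intro s hs x hx
  obtain ⟨i, rfl⟩ := hysurj x (hs.2.1 hx)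
  rw [hfy, hgc]

/-- Isolated persistent cycles in disjoint clusters contribute to the persistent rank. -/
theorem card_le_persistentRank_cech {ϑ r : ℝ} {P : Finset (E d)}
    {τ : Type*} (T : Finset τ)
    (C : τ → Finset (E d)) (hCP : ∀ t ∈ T, C t ⊆ P)
    (hdisj : ∀ t ∈ T, ∀ t' ∈ T, t ≠ t' → Disjoint (C t) (C t'))
    (hsep : ∀ t ∈ T, ∀ x ∈ C t, ∀ y ∈ P, y ∉ C t → 2 * (ϑ * r) < dist x y)
    (hcyc : ∀ t ∈ T, ∃ γ ∈ cycles 𝕜 (cech (C t) r) k, γ ∉ boundaries 𝕜 (cech (C t) (ϑ * r)) k) :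
    T.card ≤ persistentRank 𝕜 (cech P r) (cech P (ϑ * r)) k := by
  classical
  have hex : ∃ γ : τ → ((Fin (k + 1) → E d) →₀ 𝕜), ∀ t ∈ T, γ t ∈ cycles 𝕜 (cech (C t) r) k ∧
      γ t ∉ boundaries 𝕜 (cech (C t) (ϑ * r)) k := by
    choose! γ h1 h2 using hcyc
    exact ⟨γ, fun t ht => ⟨h1 t ht, h2 t ht⟩⟩
  obtain ⟨γ, hγ⟩ := hex
  have := finiteDimensional_cycles (𝕜 := 𝕜) (K := cech P r) P (fun s hs => hs.2.1) k
  refine card_le_finrank_map_mkQ _ _ T γ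
    (fun t ht => cycles_mono (cech_mono_left (hCP t ht) r) k (hγ t ht).1) ?_
  intro a ha t ht
  have hsepA : IsSeparated (cech P (ϑ * r)) (C t : Set (E d)) := by
    intro s hs x hx y hy hxC
    by_contra hyC
    have h1 := hsep t ht x hxC y (hs.2.1 hy) hyC
    exact absurd (dist_le_of_mem_cech hs hx hy) (not_le.2 h1)
  -- Restriction to the isolated cluster `C t` preserves boundaries and kills the other cycles,
  -- leaving `a t • γ t`.
  have hres := restrict_mem_boundaries (L := cech (C t) (ϑ * r)) (fun s hs h =>
    mem_cech_of_subset hs fun x hx => Finset.mem_coe.1 (h x hx)) hsepA ha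
  rw [map_sum, Finset.sum_eq_single t, map_smul, restrict_eq_self (cycles_le_chains _ _ (hγ t ht).1)
    fun s hs x hx => hs.2.1 hx] at hres
  · by_contra hne
    refine (hγ t ht).2 ?_
    have := Submodule.smul_mem _ (a t)⁻¹ hres
    rwa [smul_smul, inv_mul_cancel₀ hne, one_smul] at this
  · intro t' ht' hne
    rw [map_smul, restrict_eq_zero (cycles_le_chains _ _ (hγ t' ht').1), smul_zero]
    intro s hs x hx hxt
    exact Finset.disjoint_left.1 (hdisj t' ht' t ht hne) (hs.2.1 hx) hxt
  · exact fun h => absurd ht h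

end Deterministic

/-! ### Grids and measurability of persistent Betti numbers -/

section Grid

variable {d : ℕ}

/-- The index of the cell of the grid of mesh `h` that contains `x`. -/
def cellIndex (h : ℝ) (x : E d) : Fin d → ℤ := fun i => ⌊x i / h⌋

/-- The lower corner of a cell. -/
def cellCorner (h : ℝ) (v : Fin d → ℤ) : E d := WithLp.toLp 2 fun i => h * v i

theorem norm_le_of_forall_abs_le {x : E d} {a : ℝ} (hx : ∀ i, |x i| ≤ a) : ‖x‖ ≤ d * a := by
  have h1 : x = ∑ i, EuclideanSpace.single i (x i) := by
    ext j
    simp [Finset.sum_apply]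
  rw [h1]
  refine (norm_sum_le _ _).trans ?_
  calc ∑ i, ‖EuclideanSpace.single i (x i)‖ ≤ ∑ _i : Fin d, a :=
        Finset.sum_le_sum fun i _ => by simpa using hx i
    _ = d * a := by simp

theorem abs_sub_cellCorner_le {h : ℝ} (hh : 0 < h) (x : E d) (v : Fin d → ℤ) {a : ℕ}
    (hv : ∀ i, |⌊x i / h⌋ - v i| ≤ a) (i : Fin d) :
    |(x - cellCorner h v) i| ≤ (a + 1) * h := by
  have h1 : (x - cellCorner h v) i = (x i / h - v i) * h := by
    simp only [cellCorner, PiLp.sub_apply]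
    field_simp
  rw [h1, abs_mul, abs_of_pos hh]
  gcongr
  have h2 : |((⌊x i / h⌋ - v i : ℤ) : ℝ)| ≤ a := by exact_mod_cast hv i
  have h3 := Int.floor_le (x i / h)
  have h4 := Int.lt_floor_add_one (x i / h)
  push_cast at h2
  rw [abs_le] at h2 ⊢
  constructor <;> linarith [h2.1, h2.2]

theorem dist_cellCorner_le {h : ℝ} (hh : 0 < h) (x : E d) (v : Fin d → ℤ) {a : ℕ}
    (hv : ∀ i, |⌊x i / h⌋ - v i| ≤ a) : dist x (cellCorner h v) ≤ d * ((a + 1) * h) := by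
  rw [dist_eq_norm]
  exact norm_le_of_forall_abs_le (abs_sub_cellCorner_le hh x v hv)

theorem dist_cellCorner_cellIndex_le {h : ℝ} (hh : 0 < h) (x : E d) :
    dist (cellCorner h (cellIndex h x)) x ≤ d * h := by
  rw [dist_comm]
  simpa using dist_cellCorner_le hh x (cellIndex h x) (a := 0) (by simp [cellIndex])

theorem measurable_cellIndex (h : ℝ) : Measurable (cellIndex (d := d) h) :=
  measurable_pi_lambda _ fun i => Int.measurable_floor.comp (by fun_prop)

theorem isSimplicial_cech_of_dist_le {P P' : Finset (E d)} {f : E d → E d} {r η : ℝ}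
    (hf : ∀ x ∈ P, f x ∈ P' ∧ dist (f x) x ≤ η) : IsSimplicial (cech P r) (cech P' (r + η)) f := by
  classical
  rintro s ⟨hne, hsP, z, hz⟩
  refine ⟨s.image f, ⟨hne.image _, ?_, z, ?_⟩, fun x hx => Finset.mem_image_of_mem _ hx⟩
  · intro x hx
    obtain ⟨x, hxs, rfl⟩ := Finset.mem_image.1 hx
    exact (hf x (hsP hxs)).1
  · simp only [Set.mem_iInter, Metric.mem_closedBall, Finset.mem_image] at hz ⊢
    rintro _ ⟨x, hx, rfl⟩
    have h1 := hz x hx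
    have h2 := (hf x (hsP hx)).2
    have h3 := dist_triangle_right z (f x) x
    linarith

variable (𝕜 : Type*) [Field 𝕜]

open Classical in
/-- The persistent rank of a finite set does not change if its points are moved slightly and the
radii are enlarged accordingly. -/
theorem eventually_persistentRank_round (P : Finset (E d)) (r s : ℝ) (k : ℕ) :
    ∀ᶠ h in 𝓝[>] (0 : ℝ),
      persistentRank 𝕜 (cech ((P.image (cellIndex h)).image (cellCorner h)) (r + d * h))
        (cech ((P.image (cellIndex h)).image (cellCorner h)) (s + d * h)) k =
      persistentRank 𝕜 (cech P r) (cech P s) k := by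
  have h1 : ∀ᶠ h in 𝓝[>] (0 : ℝ), 0 < h := self_mem_nhdsWithin
  -- In dimension 0 the enlargement `d * h` is not positive, but there rounding is the identity.
  rcases Nat.eq_zero_or_pos d with rfl | hd
  · filter_upwards [h1] with h hh
    have : (P.image (cellIndex h)).image (cellCorner h) = P := by
      have hid : cellCorner h ∘ cellIndex (d := 0) h = id := funext fun _ => Subsingleton.elim _ _
      rw [Finset.image_image, hid, Finset.image_id]
    rw [this]
    simp
  have hd' : (0 : ℝ) < d := by exact_mod_cast hd
  have h2 : Tendsto (fun h : ℝ => d * h + d * h) (𝓝[>] 0) (𝓝[>] 0) := by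
    refine tendsto_nhdsWithin_iff.2 ⟨?_, ?_⟩
    · have : Tendsto (fun h : ℝ => d * h + d * h) (𝓝 0) (𝓝 (d * 0 + d * 0)) :=
        Continuous.tendsto (by fun_prop) 0
      simp only [mul_zero, add_zero] at this
      exact this.mono_left nhdsWithin_le_nhds
    · filter_upwards [h1] with h hh
      exact Set.mem_Ioi.2 (by positivity)
  -- Two distinct points further apart than twice the rounding error are not rounded together.
  have h3 : ∀ᶠ h in 𝓝[>] (0 : ℝ), ∀ x ∈ P, ∀ y ∈ P, x ≠ y → d * h + d * h < dist x y := by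
    refine (Filter.eventually_all_finset _).2 fun x _ => (Filter.eventually_all_finset _).2
      fun y _ => ?_
    by_cases hxy : x = y
    · exact Eventually.of_forall fun _ h => absurd hxy h
    · filter_upwards [h2.eventually (Ioo_mem_nhdsGT (dist_pos.2 hxy))] with h hh _
      exact hh.2
  filter_upwards [h1, h3, h2.eventually (eventually_cech_le P r),
    h2.eventually (eventually_cech_le P s)] with h hh hinj hr hs
  set P' := (P.image (cellIndex h)).image (cellCorner h)
  let f : E d → E d := fun x => cellCorner h (cellIndex h x)
  have hf : ∀ x ∈ P, f x ∈ P' ∧ dist (f x) x ≤ d * h := fun x hx =>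
    ⟨Finset.mem_image_of_mem _ (Finset.mem_image_of_mem _ hx), dist_cellCorner_cellIndex_le hh x⟩
  have hfinj : Set.InjOn f P := by
    intro x hx y hy hxy
    by_contra hne
    have := hinj x hx y hy hne
    have h4 := dist_triangle_left x y (f x)
    have h5 := (hf x hx).2
    have h6 := (hf y hy).2
    rw [← hxy] at h6
    linarith
  have hsurj : ∀ y ∈ P', ∃ x ∈ P, f x = y := by
    intro y hy
    obtain ⟨v, hv, rfl⟩ := Finset.mem_image.1 hy
    obtain ⟨x, hx, rfl⟩ := Finset.mem_image.1 hv
    exact ⟨x, hx, rfl⟩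
  let g : E d → E d := Function.invFunOn f P
  have hgf : ∀ x ∈ P, g (f x) = x := fun x hx => hfinj.leftInvOn_invFunOn hx
  have hg : ∀ y ∈ P', g y ∈ P ∧ dist (g y) y ≤ d * h := by
    intro y hy
    obtain ⟨x, hx, rfl⟩ := hsurj y hy
    rw [hgf x hx, dist_comm]
    exact ⟨hx, (hf x hx).2⟩
  have hfg : ∀ y ∈ P', f (g y) = y := by
    intro y hy
    obtain ⟨x, hx, rfl⟩ := hsurj y hy
    rw [hgf x hx]
  have hgs : ∀ t, cech P (t + (d * h + d * h)) ≤ cech P t →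
      IsSimplicial (cech P' (t + d * h)) (cech P t) g := by
    intro t ht s hs
    obtain ⟨s', hs', h'⟩ := isSimplicial_cech_of_dist_le (r := t + d * h) hg s hs
    rw [add_assoc] at hs'
    exact ⟨s', ht hs', h'⟩
  -- The retract lemma is applied both ways with `f` and its inverse `g`. Each moves points by at
  -- most `d * h`, and right continuity discards the total enlargement `d * h + d * h`.
  refine le_antisymm ?_ ?_
  · exact persistentRank_le_of_retract P (fun s (hs : s ∈ cech P r) => hs.2.1) (hgs r hr)
      (isSimplicial_cech_of_dist_le hf) (fun s (hs : s ∈ cech P' _) x hx => hfg x (hs.2.1 hx)) k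
  · exact persistentRank_le_of_retract P' (fun s (hs : s ∈ cech P' (r + d * h)) => hs.2.1)
      (isSimplicial_cech_of_dist_le hf)
      (hgs s hs) (fun s (hs : s ∈ cech P _) x hx => hgf x (hs.2.1 hx)) k

/-- Persistent ranks of random finite sets are measurable. -/
theorem measurable_persistentRank {Ω : Type*} [MeasurableSpace Ω] {P : Ω → Finset (E d)}
    (hP : ∀ A : Set (E d), MeasurableSet A → Measurable fun ω => ((P ω : Set (E d)) ∩ A).ncard)
    (r s : ℝ) (k : ℕ) :
    Measurable fun ω => persistentRank 𝕜 (cech (P ω) r) (cech (P ω) s) k := by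
  classical
  let h : ℕ → ℝ := fun n => 1 / (n + 1)
  have hh : Tendsto h atTop (𝓝[>] 0) := tendsto_nhdsWithin_iff.2
    ⟨tendsto_one_div_add_atTop_nhds_zero_nat, Eventually.of_forall fun n => by
      simp only [h, Set.mem_Ioi]; positivity⟩
  -- The rank is the pointwise limit of ranks of rounded sets. Each of these depends only on the set
  -- of occupied cells, which takes countably many values and is read off from the counts.
  refine measurable_of_tendsto_metrizable (f := fun n ω =>
    persistentRank 𝕜 (cech (((P ω).image (cellIndex (h n))).image (cellCorner (h n)))
      (r + d * h n)) (cech (((P ω).image (cellIndex (h n))).image (cellCorner (h n)))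
      (s + d * h n)) k) (fun n => ?_) ?_
  · let _ : MeasurableSpace (Finset (Fin d → ℤ)) := ⊤
    have hS : Measurable fun ω => (P ω).image (cellIndex (h n)) := by
      refine measurable_to_countable' fun S => ?_
      have : (fun ω => (P ω).image (cellIndex (h n))) ⁻¹' {S} = ⋂ v : Fin d → ℤ,
          {ω | ((P ω : Set (E d)) ∩ cellIndex (h n) ⁻¹' {v}).ncard ≠ 0 ↔ v ∈ S} := by
        ext ω
        simp only [Set.mem_preimage, Set.mem_singleton_iff, Set.mem_iInter]
        rw [Finset.ext_iff]
        refine forall_congr' fun v => ?_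
        have h1 : ((P ω : Set (E d)) ∩ cellIndex (h n) ⁻¹' {v}).ncard ≠ 0 ↔
            v ∈ (P ω).image (cellIndex (h n)) := by
          rw [Ne, Set.ncard_eq_zero ((P ω).finite_toSet.inter_of_left _),
            ← Ne, ← Set.nonempty_iff_ne_empty, Finset.mem_image]
          rfl
        exact iff_congr h1.symm Iff.rfl
      rw [this]
      refine MeasurableSet.iInter fun v => ?_
      have hm := hP _ (measurable_cellIndex (h n) (MeasurableSet.singleton v))
      exact hm (MeasurableSet.of_discrete (s := {j : ℕ | j ≠ 0 ↔ v ∈ S}))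
    have hF : Measurable fun S : Finset (Fin d → ℤ) =>
        persistentRank 𝕜 (cech (S.image (cellCorner (h n))) (r + d * h n))
          (cech (S.image (cellCorner (h n))) (s + d * h n)) k := measurable_from_top
    exact hF.comp hS
  · refine tendsto_pi_nhds.2 fun ω => ?_
    refine tendsto_const_nhds.congr' ?_
    filter_upwards [hh.eventually (eventually_persistentRank_round 𝕜 (P ω) r s k)] with n hn
    exact hn.symm

end Grid

/-! ### Upper bound on the expectation -/

open scoped NNReal ENNReal Nat

/-! ### Moments and truncated moments of Poisson variables -/

section PoissonMoments

theorem lintegral_poissonMeasure (Λ : ℝ≥0) (g : ℕ → ℝ≥0∞) :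
    ∫⁻ j, g j ∂(poissonMeasure Λ) =
      ∑' j : ℕ, ENNReal.ofReal (Real.exp (-Λ) * Λ ^ j / j !) * g j := by
  rw [poissonMeasure, lintegral_sum_measure]
  refine tsum_congr fun j => ?_
  rw [lintegral_smul_measure, lintegral_dirac, smul_eq_mul]

/-- Since `j ^ p ≤ p ! * exp j`, the series is dominated by that of `exp (e * a)`. -/
theorem summable_pow_mul_pow_div_factorial (p : ℕ) {a : ℝ} (ha : 0 ≤ a) :
    Summable fun j : ℕ => (j : ℝ) ^ p * a ^ j / j ! := by
  refine Summable.of_nonneg_of_le (fun j => by positivity) (fun j => ?_)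
    ((Real.summable_pow_div_factorial (Real.exp 1 * a)).mul_left (p ! : ℝ))
  have h1 := Real.pow_div_factorial_le_exp (j : ℝ) (Nat.cast_nonneg j) p
  rw [div_le_iff₀ (by positivity), mul_comm] at h1
  rw [mul_pow, ← Real.exp_nat_mul, mul_one, mul_div_assoc, mul_div_assoc, ← mul_assoc]
  gcongr

theorem lintegral_pow_poissonMeasure_lt_top (Λ : ℝ≥0) (p : ℕ) :
    ∫⁻ j, (j : ℝ≥0∞) ^ p ∂(poissonMeasure Λ) < ⊤ := by
  rw [lintegral_poissonMeasure]
  have h1 := (summable_pow_mul_pow_div_factorial p (NNReal.coe_nonneg Λ)).mul_left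
    (Real.exp (-Λ))
  refine lt_of_eq_of_lt (tsum_congr fun j => ?_) h1.tsum_ofReal_lt_top
  rw [← ENNReal.ofReal_natCast, ← ENNReal.ofReal_pow (by positivity),
    ← ENNReal.ofReal_mul (by positivity)]
  congr 1
  ring

/-- The truncated moments of Poisson variables. -/
def truncatedPow (m p j : ℕ) : ℝ≥0∞ := if m ≤ j then (j : ℝ≥0∞) ^ p else 0

/-- Only terms with `j ≥ m` remain, and there `Λ ^ j ≤ Λ ^ m`, so `Λ ^ m` factors out of a
convergent series independent of `Λ`. -/
theorem exists_lintegral_truncatedPow_le (m p : ℕ) : ∃ K : ℝ≥0∞, K ≠ ⊤ ∧ ∀ Λ : ℝ≥0, Λ ≤ 1 →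
    ∫⁻ j, truncatedPow m p j ∂(poissonMeasure Λ) ≤ K * (Λ : ℝ≥0∞) ^ m := by
  refine ⟨∑' j : ℕ, ENNReal.ofReal ((j : ℝ) ^ p * 1 ^ j / j !),
    (summable_pow_mul_pow_div_factorial p zero_le_one).tsum_ofReal_ne_top, fun Λ hΛ => ?_⟩
  rw [lintegral_poissonMeasure, ← ENNReal.tsum_mul_right]
  refine ENNReal.tsum_le_tsum fun j => ?_
  rw [truncatedPow]
  split_ifs with hj
  · rw [← ENNReal.ofReal_natCast, ← ENNReal.ofReal_pow (by positivity),
      ← ENNReal.ofReal_mul (by positivity), ← ENNReal.ofReal_coe_nnreal,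
      ← ENNReal.ofReal_pow (by positivity), ← ENNReal.ofReal_mul (by positivity)]
    refine ENNReal.ofReal_le_ofReal ?_
    have h1 : Real.exp (-(Λ : ℝ)) ≤ 1 := Real.exp_le_one_iff.2 (by simp)
    have h2 : (Λ : ℝ) ^ j ≤ (Λ : ℝ) ^ m :=
      pow_le_pow_of_le_one (by positivity) (by exact_mod_cast hΛ) hj
    calc Real.exp (-(Λ : ℝ)) * (Λ : ℝ) ^ j / j ! * (j : ℝ) ^ p
        ≤ 1 * (Λ : ℝ) ^ m / j ! * (j : ℝ) ^ p := by gcongr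
      _ = _ := by ring
  · simp

end PoissonMoments

/-! ### Localising the persistent rank to grid cells -/

section UpperBound

variable {d : ℕ}

/-- The union of the cells adjacent to a given cell. -/
def cellStar (h : ℝ) (v : Fin d → ℤ) : Set (E d) := {x | ∀ i, |cellIndex h x i - v i| ≤ 1}

theorem measurableSet_cellStar (h : ℝ) (v : Fin d → ℤ) : MeasurableSet (cellStar h v) :=
  measurable_cellIndex h (MeasurableSet.of_discrete (s := {w : Fin d → ℤ | ∀ i, |w i - v i| ≤ 1}))

theorem mem_cellStar_of_dist_le {h : ℝ} (hh : 0 < h) {x y : E d} (hxy : dist x y ≤ h) :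
    y ∈ cellStar h (cellIndex h x) := by
  intro i
  have h1 := (abs_apply_sub_le x y i).trans hxy
  have h2 : |x i / h - y i / h| ≤ 1 := by
    rw [← sub_div, abs_div, abs_of_pos hh]
    exact (div_le_one hh).2 h1
  rw [abs_le] at h2
  have h3 : ⌊y i / h⌋ ≤ ⌊x i / h⌋ + 1 := by
    rw [← Int.floor_add_one]
    exact Int.floor_le_floor (by linarith [h2.1])
  have h4 : ⌊x i / h⌋ ≤ ⌊y i / h⌋ + 1 := by
    rw [← Int.floor_add_one]
    exact Int.floor_le_floor (by linarith [h2.2])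
  simp only [cellIndex]
  rw [abs_le]
  constructor <;> linarith

theorem volume_cellStar_le {h : ℝ} (hh : 0 < h) (v : Fin d → ℤ) :
    volume (cellStar h v) ≤
      ENNReal.ofReal ((d * (2 * h)) ^ d) * volume (Metric.ball (0 : E d) 1) := by
  have hsub : cellStar h v ⊆ Metric.closedBall (cellCorner h v) (d * (2 * h)) := by
    intro x hx
    have := dist_cellCorner_le hh x v (a := 1) (by simpa [cellStar, cellIndex] using hx)
    norm_num at this
    exact this
  refine (measure_mono hsub).trans ?_
  rw [Measure.addHaar_closedBall _ _ (by positivity), finrank_euclideanSpace_fin]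

/-- Each point lies in the stars of only the `3 ^ d` cells around its own. -/
theorem tsum_setLIntegral_cellStar_le (h : ℝ) {u : E d → ℝ≥0∞} (hu : Measurable u) :
    ∑' v, ∫⁻ x in cellStar h v, u x ≤ 3 ^ d * ∫⁻ x, u x := by
  simp_rw [← lintegral_indicator (measurableSet_cellStar h _)]
  rw [← lintegral_tsum fun v => (hu.indicator (measurableSet_cellStar h v)).aemeasurable,
    ← lintegral_const_mul _ hu]
  refine lintegral_mono fun x => ?_
  rw [tsum_eq_sum (s := Fintype.piFinset fun i => Finset.Icc (cellIndex h x i - 1)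
    (cellIndex h x i + 1))]
  · refine (Finset.sum_le_card_nsmul _ _ (u x) fun v _ => Set.indicator_le_self _ _ _).trans ?_
    rw [Fintype.card_piFinset, nsmul_eq_mul]
    refine mul_le_mul_left (le_of_eq ?_) _
    simp only [Int.card_Icc]
    have : ∀ a : ℤ, (a + 1 + 1 - (a - 1)).toNat = 3 := fun a => by
      rw [show a + 1 + 1 - (a - 1) = 3 by ring]; rfl
    simp [this]
  · intro v hv
    refine Set.indicator_of_notMem (fun hx => hv ?_) _
    rw [Fintype.mem_piFinset]
    intro i
    have := abs_le.1 (hx i)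
    rw [Finset.mem_Icc]
    constructor <;> linarith [this.1, this.2]

theorem setLIntegral_cellStar_le {f : E d → ℝ} {M : ℝ} (hM : ∀ x, f x ≤ M) {κ r : ℝ} (hκ : 0 < κ)
    (hr : 0 < r) (n : ℕ) (v : Fin d → ℤ) :
    ∫⁻ x in cellStar (κ * r) v, ENNReal.ofReal (n * f x) ≤
      ENNReal.ofReal (|M| * (d * (2 * κ)) ^ d) * volume (Metric.ball (0 : E d) 1) *
        ENNReal.ofReal (r ^ d * n) := by
  calc ∫⁻ x in cellStar (κ * r) v, ENNReal.ofReal (n * f x)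
      ≤ ∫⁻ _ in cellStar (κ * r) v, ENNReal.ofReal (n * |M|) := by
        refine lintegral_mono fun x => ENNReal.ofReal_le_ofReal ?_
        gcongr
        exact (hM x).trans (le_abs_self M)
    _ ≤ ENNReal.ofReal (n * |M|) * (ENNReal.ofReal ((d * (2 * (κ * r))) ^ d) *
          volume (Metric.ball (0 : E d) 1)) := by
        rw [setLIntegral_const]
        gcongr
        exact volume_cellStar_le (by positivity) v
    _ = _ := by
        rw [← mul_assoc, ← ENNReal.ofReal_mul (by positivity), mul_right_comm _ (volume _),
          ← ENNReal.ofReal_mul (by positivity)]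
        congr 2
        simp only [mul_pow]
        ring

variable (𝕜 : Type*) [Field 𝕜]

theorem persistentRank_cech_le_pow {k : ℕ} {ϑ r : ℝ} (hr : 0 < r) (P : Finset (E d)) :
    persistentRank 𝕜 (cech P r) (cech P (ϑ * r)) k ≤ P.card ^ (k + 1) := by
  classical
  refine (persistentRank_cech_le 𝕜 hr P).trans ((Finset.card_filter_le _ _).trans ?_)
  simp [Fintype.card_piFinset]

/-- The persistent rank is bounded by a sum of local contributions. -/
theorem persistentRank_cech_le_tsum {k : ℕ} {ϑ r : ℝ} (hr : 0 < r)
    (hm : 1 ≤ minCycleSize 𝕜 d k ϑ) (P : Finset (E d)) :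
    (persistentRank 𝕜 (cech P r) (cech P (ϑ * r)) k : ℝ≥0∞) ≤
      ∑' v, truncatedPow (minCycleSize 𝕜 d k ϑ) (k + 1)
        ((P : Set (E d)) ∩ cellStar (2 * r * minCycleSize 𝕜 d k ϑ) v).ncard := by
  classical
  set m := minCycleSize 𝕜 d k ϑ
  have hm' : (1 : ℝ) ≤ m := by exact_mod_cast hm
  set h := 2 * r * m
  have hh : 0 < h := by positivity
  have hrh : 2 * r ≤ h := le_mul_of_one_le_right (by positivity) hm'
  let Q : (Fin d → ℤ) → Finset (E d) := fun v => P.filter (· ∈ cellStar h v)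
  have hQ : ∀ v, ((P : Set (E d)) ∩ cellStar h v).ncard = (Q v).card := fun v => by
    rw [← Set.ncard_coe_finset]
    congr 1
    ext x
    simp [Q]
  -- A tuple is charged to the cell of its first vertex. The mesh `h = 2 * r * m` puts the tuple and
  -- the `m` nearby points in the star of that cell.
  have hsub : ((Fintype.piFinset fun _ : Fin (k + 1) => P).filter fun x =>
        (∀ i, dist (x 0) (x i) ≤ 2 * r) ∧ m ≤ (P.filter fun y => dist (x 0) y ≤ h).card) ⊆
      (P.image (cellIndex h)).biUnion fun v =>
        if m ≤ (Q v).card then Fintype.piFinset fun _ : Fin (k + 1) => Q v else ∅ := by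
    intro x hx
    obtain ⟨hxP, hxd, hxm⟩ := Finset.mem_filter.1 hx
    rw [Fintype.mem_piFinset] at hxP
    refine Finset.mem_biUnion.2 ⟨_, Finset.mem_image_of_mem _ (hxP 0), ?_⟩
    rw [if_pos, Fintype.mem_piFinset]
    · exact fun i => Finset.mem_filter.2 ⟨hxP i, mem_cellStar_of_dist_le hh ((hxd i).trans hrh)⟩
    · refine hxm.trans (Finset.card_le_card fun y hy => ?_)
      obtain ⟨hyP, hyd⟩ := Finset.mem_filter.1 hy
      exact Finset.mem_filter.2 ⟨hyP, mem_cellStar_of_dist_le hh hyd⟩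
  have h1 := (persistentRank_cech_le 𝕜 (k := k) (ϑ := ϑ) hr P).trans
    ((Finset.card_le_card hsub).trans Finset.card_biUnion_le)
  calc (persistentRank 𝕜 (cech P r) (cech P (ϑ * r)) k : ℝ≥0∞)
      ≤ ((∑ v ∈ P.image (cellIndex h), (if m ≤ (Q v).card then
          Fintype.piFinset fun _ : Fin (k + 1) => Q v else ∅).card : ℕ) : ℝ≥0∞) := by
        exact_mod_cast h1
    _ = ∑ v ∈ P.image (cellIndex h), truncatedPow m (k + 1)
          ((P : Set (E d)) ∩ cellStar h v).ncard := by
        rw [Nat.cast_sum]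
        refine Finset.sum_congr rfl fun v _ => ?_
        rw [hQ, truncatedPow]
        split_ifs <;> simp [Fintype.card_piFinset]
    _ ≤ _ := ENNReal.sum_le_tsum _

end UpperBound

/-! ### Integrability and the expected upper bound -/

section Expectation

variable {d : ℕ} {Ω : Type*} [MeasurableSpace Ω] {μ : Measure Ω} {P : Ω → Finset (E d)}
  {lam : E d → ℝ}

theorem IsPoissonProcess.lintegral_count (hP : IsPoissonProcess P lam μ) {A : Set (E d)}
    (hA : MeasurableSet A) (hfin : ∫⁻ x in A, ENNReal.ofReal (lam x) ≠ ⊤) (g : ℕ → ℝ≥0∞) :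
    ∫⁻ ω, g ((P ω : Set (E d)) ∩ A).ncard ∂μ =
      ∫⁻ j, g j ∂(poissonMeasure (∫⁻ x in A, ENNReal.ofReal (lam x)).toNNReal) :=
  (hP.hasLaw_count A hA hfin).lintegral_comp (f := g) (by fun_prop)

variable (𝕜 : Type*) [Field 𝕜]

/-- The rank is at most the `(k + 1)`-st power of the total number of points, a Poisson variable
with finite mean. -/
theorem IsPoissonProcess.integrable_persistentRank (hP : IsPoissonProcess P lam μ)
    (hfin : ∫⁻ x, ENNReal.ofReal (lam x) ≠ ⊤) {k : ℕ} {ϑ r : ℝ} (hr : 0 < r) :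
    Integrable (fun ω => (persistentRank 𝕜 (cech (P ω) r) (cech (P ω) (ϑ * r)) k : ℝ)) μ := by
  have hm := measurable_persistentRank 𝕜 hP.measurable_count r (ϑ * r) k
  refine ⟨(measurable_from_top.comp hm).aestronglyMeasurable, ?_⟩
  have h1 : ∫⁻ ω, ((((P ω : Set (E d)) ∩ Set.univ).ncard : ℕ) : ℝ≥0∞) ^ (k + 1) ∂μ < ⊤ := by
    rw [hP.lintegral_count MeasurableSet.univ (by simpa using hfin)
      (g := fun j => (j : ℝ≥0∞) ^ (k + 1))]
    exact lintegral_pow_poissonMeasure_lt_top _ _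
  refine lt_of_le_of_lt (lintegral_mono fun ω => ?_) h1
  have h2 := persistentRank_cech_le_pow 𝕜 (k := k) (ϑ := ϑ) hr (P ω)
  rw [Set.inter_univ, Set.ncard_coe_finset, Real.enorm_of_nonneg (Nat.cast_nonneg _),
    ENNReal.ofReal_natCast, ← Nat.cast_pow]
  exact Nat.cast_le.2 h2

theorem lintegral_nat_mul_density {f : E d → ℝ} (hf : Measurable f)
    (hf_density : ∫⁻ x, ENNReal.ofReal (f x) = 1) (n : ℕ) :
    ∫⁻ x, ENNReal.ofReal (n * f x) = n := by
  simp_rw [ENNReal.ofReal_mul (Nat.cast_nonneg n)]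
  rw [lintegral_const_mul _ (by fun_prop), hf_density, mul_one, ENNReal.ofReal_natCast]

/-- The upper bound on the expected persistent rank. -/
theorem exists_lintegral_persistentRank_le {f : E d → ℝ} (hf : Measurable f) {M : ℝ}
    (hM : ∀ x, f x ≤ M) (hf_density : ∫⁻ x, ENNReal.ofReal (f x) = 1) {k : ℕ} {ϑ : ℝ}
    (hm : 1 ≤ minCycleSize 𝕜 d k ϑ) :
    ∃ A : ℝ≥0∞, A ≠ ⊤ ∧ ∃ ε : ℝ, 0 < ε ∧ ∀ (n : ℕ) (r : ℝ), 0 < r → r ^ d * n ≤ ε →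
      ∀ {Ω : Type*} [MeasurableSpace Ω] {μ : Measure Ω} {P : Ω → Finset (E d)},
        IsPoissonProcess P (fun x => n * f x) μ →
        ∫⁻ ω, (persistentRank 𝕜 (cech (P ω) r) (cech (P ω) (ϑ * r)) k : ℝ≥0∞) ∂μ ≤
          A * ENNReal.ofReal (n * (r ^ d * n) ^ (minCycleSize 𝕜 d k ϑ - 1)) := by
  set m := minCycleSize 𝕜 d k ϑ
  obtain ⟨K, hK, hKm⟩ := exists_lintegral_truncatedPow_le m (k + 1)
  set B : ℝ≥0∞ := ENNReal.ofReal (|M| * (d * (2 * (2 * m))) ^ d) *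
    volume (Metric.ball (0 : E d) 1) with hB
  have hBtop : B ≠ ⊤ := ENNReal.mul_ne_top ENNReal.ofReal_ne_top measure_ball_lt_top.ne
  -- `K` comes from the truncated moment, `B ^ (m - 1)` from the uniform mass bound and `3 ^ d` from
  -- the overlap of stars. The threshold forces every mass to be at most 1.
  refine ⟨K * B ^ (m - 1) * 3 ^ d, by finiteness, (B.toReal + 1)⁻¹, by positivity, ?_⟩
  intro n r hr hrn Ω _ μ P hP
  have hm' : (1 : ℝ) ≤ m := by exact_mod_cast hm
  have hh : 0 < 2 * r * m := by positivity
  set Λ : (Fin d → ℤ) → ℝ≥0∞ := fun v =>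
    ∫⁻ x in cellStar (2 * r * m) v, ENNReal.ofReal (n * f x) with hΛ
  have hΛB : ∀ v, Λ v ≤ B * ENNReal.ofReal (r ^ d * n) := by
    intro v
    have := setLIntegral_cellStar_le hM (κ := 2 * m) (by positivity) hr n v
    rwa [mul_right_comm] at this
  have hΛ1 : ∀ v, Λ v ≤ 1 := by
    intro v
    refine (hΛB v).trans ?_
    rw [← ENNReal.ofReal_toReal hBtop, ← ENNReal.ofReal_mul ENNReal.toReal_nonneg,
      ENNReal.ofReal_le_one]
    calc B.toReal * (r ^ d * n) ≤ B.toReal * (B.toReal + 1)⁻¹ := by gcongr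
      _ ≤ 1 := by
        rw [mul_inv_le_iff₀ (by positivity)]
        linarith
  have hterm : ∀ v, ∫⁻ ω, truncatedPow m (k + 1)
      ((P ω : Set (E d)) ∩ cellStar (2 * r * m) v).ncard ∂μ ≤
      K * B ^ (m - 1) * ENNReal.ofReal ((r ^ d * n) ^ (m - 1)) * Λ v := by
    intro v
    have hne : Λ v ≠ ⊤ := ((hΛ1 v).trans_lt ENNReal.one_lt_top).ne
    rw [hP.lintegral_count (measurableSet_cellStar _ v) hne]
    refine (hKm _ ?_).trans ?_
    · rw [← ENNReal.coe_le_coe, ENNReal.coe_toNNReal hne]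
      exact hΛ1 v
    · rw [ENNReal.coe_toNNReal hne]
      -- One factor `Λ v` is kept for summation over the cells; the other `m - 1` are bounded
      -- uniformly.
      calc K * Λ v ^ m = K * (Λ v ^ (m - 1) * Λ v) := by
            rw [← pow_succ, Nat.sub_add_cancel hm]
        _ ≤ K * ((B * ENNReal.ofReal (r ^ d * n)) ^ (m - 1) * Λ v) := by
            gcongr
            exact hΛB v
        _ = _ := by
            rw [mul_pow, ENNReal.ofReal_pow (by positivity)]
            ring
  calc ∫⁻ ω, (persistentRank 𝕜 (cech (P ω) r) (cech (P ω) (ϑ * r)) k : ℝ≥0∞) ∂μ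
      ≤ ∫⁻ ω, ∑' v, truncatedPow m (k + 1)
          ((P ω : Set (E d)) ∩ cellStar (2 * r * m) v).ncard ∂μ :=
        lintegral_mono fun ω => persistentRank_cech_le_tsum 𝕜 hr hm (P ω)
    _ = ∑' v, ∫⁻ ω, truncatedPow m (k + 1)
          ((P ω : Set (E d)) ∩ cellStar (2 * r * m) v).ncard ∂μ :=
        lintegral_tsum fun v => ((measurable_from_top (f := truncatedPow m (k + 1))).comp
          (hP.measurable_count _ (measurableSet_cellStar _ v))).aemeasurable
    _ ≤ ∑' v, K * B ^ (m - 1) * ENNReal.ofReal ((r ^ d * n) ^ (m - 1)) * Λ v :=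
        ENNReal.tsum_le_tsum hterm
    _ = K * B ^ (m - 1) * ENNReal.ofReal ((r ^ d * n) ^ (m - 1)) * ∑' v, Λ v :=
        ENNReal.tsum_mul_left
    _ ≤ K * B ^ (m - 1) * ENNReal.ofReal ((r ^ d * n) ^ (m - 1)) * (3 ^ d * n) := by
        gcongr
        refine (tsum_setLIntegral_cellStar_le _ (by fun_prop)).trans ?_
        rw [lintegral_nat_mul_density hf hf_density]
    _ = _ := by
        rw [ENNReal.ofReal_mul (Nat.cast_nonneg n), ENNReal.ofReal_natCast]
        ring

end Expectation

/-! ### Lower bound on the expectation -/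

/-! ### Ball masses summed over cells, by Lebesgue differentiation -/

section LebesgueDensity

variable {d : ℕ}

/-- The balls of a scaled configuration placed in a cell of the grid. -/
def configBall {m : ℕ} (κ ε : ℝ) (y : Fin m → E d) (r : ℝ) (v : Fin d → ℤ) (i : Fin m) :
    Set (E d) :=
  Metric.closedBall (cellCorner (κ * r) v + r • y i) (ε * r)

theorem volume_configBall {m : ℕ} {κ ε : ℝ} (hε : 0 < ε) (y : Fin m → E d) {r : ℝ} (hr : 0 < r)
    (v : Fin d → ℤ) (i : Fin m) :
    volume (configBall κ ε y r v i) =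
      ENNReal.ofReal (ε ^ d) * volume (Metric.ball (0 : E d) 1) * ENNReal.ofReal (r ^ d) := by
  rw [configBall, Measure.addHaar_closedBall _ _ (by positivity), finrank_euclideanSpace_fin,
    mul_pow, ENNReal.ofReal_mul (by positivity)]
  ring

theorem volume_cell_le {h : ℝ} (hh : 0 < h) (v : Fin d → ℤ) :
    volume (cellIndex h ⁻¹' {v}) ≤
      ENNReal.ofReal ((d * (2 * h)) ^ d) * volume (Metric.ball (0 : E d) 1) := by
  refine (measure_mono ?_).trans (volume_cellStar_le hh v)
  intro x hx i
  rw [show cellIndex h x = v from hx]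
  simp

theorem lintegral_comp_cellIndex (h : ℝ) (F : (Fin d → ℤ) → ℝ≥0∞) :
    ∫⁻ x, F (cellIndex h x) = ∑' v, F v * volume (cellIndex (d := d) h ⁻¹' {v}) := by
  rw [← lintegral_map (f := F) (by fun_prop) (measurable_cellIndex h), lintegral_countable']
  refine tsum_congr fun v => ?_
  rw [Measure.map_apply (measurable_cellIndex h) (MeasurableSet.singleton v)]

/-- After division by the ball volumes, the summand is a product of `m + 1` averages of `f` near the
cell. One volume factor turns the sum over cells into an integral, leaving `m`. Almost everywhere
the product tends to `f ^ (m + 1)`, whose integral is positive, and Fatou's lemma gives the lower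
bound. -/
theorem exists_le_tsum_prod_configBall {f : E d → ℝ} (hf : Measurable f) (hf0 : ∀ x, 0 ≤ f x)
    (hf_density : ∫⁻ x, ENNReal.ofReal (f x) = 1) {m : ℕ} (y : Fin (m + 1) → E d) {κ ε : ℝ}
    (hκ : 0 < κ) (hε : 0 < ε) {r : ℕ → ℝ} (hr : Tendsto r atTop (𝓝[>] 0)) :
    ∃ c : ℝ≥0∞, c ≠ 0 ∧ ∀ᶠ n in atTop, c * ENNReal.ofReal (r n ^ d) ^ m ≤
      ∑' v, ∏ i, ∫⁻ x in configBall κ ε y (r n) v i, ENNReal.ofReal (f x) := by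
  have hr0 : ∀ᶠ n in atTop, 0 < r n := hr.eventually self_mem_nhdsWithin
  have hint : Integrable f := by
    refine ⟨hf.aestronglyMeasurable, ?_⟩
    rw [hasFiniteIntegral_iff_ofReal (Eventually.of_forall hf0), hf_density]
    exact ENNReal.one_lt_top
  let F : ℕ → (Fin d → ℤ) → ℝ≥0∞ := fun n v =>
    ∏ i, ENNReal.ofReal (⨍ x in configBall κ ε y (r n) v i, f x)
  have hlim : ∀ᵐ x : E d, Tendsto (fun n => F n (cellIndex (κ * r n) x)) atTop
      (𝓝 (ENNReal.ofReal (f x) ^ (m + 1))) := by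
    -- The balls are not centred at `x`, but their centres stay within `K` times their radius of it,
    -- which the differentiation theorem permits.
    let K : ℝ := (d * κ + ∑ i, ‖y i‖) / ε
    have hK := IsUnifLocDoublingMeasure.ae_tendsto_average (μ := (volume : Measure (E d)))
      hint.locallyIntegrable K
    filter_upwards [hK] with x hx
    have hprod : Tendsto (fun n => F n (cellIndex (κ * r n) x)) atTop
        (𝓝 (ENNReal.ofReal (∏ _i : Fin (m + 1), f x))) := by
      have hF : ∀ n v, F n v =
          ENNReal.ofReal (∏ i, ⨍ x in configBall κ ε y (r n) v i, f x) := fun n v =>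
        (ENNReal.ofReal_prod_of_nonneg fun i _ => integral_nonneg hf0).symm
      simp_rw [hF]
      refine ENNReal.tendsto_ofReal (tendsto_finsetProd _ fun i _ => ?_)
      refine hx _ _ ?_ ?_
      · refine tendsto_nhdsWithin_iff.2 ⟨?_, ?_⟩
        · simpa using ((tendsto_nhdsWithin_iff.1 hr).1.const_mul ε)
        · filter_upwards [hr0] with n hn
          exact Set.mem_Ioi.2 (by positivity)
      · filter_upwards [hr0] with n hn
        rw [Metric.mem_closedBall]
        have h1 : K * (ε * r n) = d * (κ * r n) + r n * ∑ i, ‖y i‖ := by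
          simp only [K]
          field_simp
        rw [h1]
        refine (dist_triangle _ (cellCorner (κ * r n) (cellIndex (κ * r n) x)) _).trans ?_
        rw [dist_comm x, dist_self_add_right, norm_smul, Real.norm_of_nonneg hn.le]
        gcongr
        · exact dist_cellCorner_cellIndex_le (by positivity) x
        · exact Finset.single_le_sum (f := fun i => ‖y i‖) (fun _ _ => norm_nonneg _)
            (Finset.mem_univ i)
    simpa [ENNReal.ofReal_pow (hf0 x)] using hprod
  have hpos : 0 < ∫⁻ x, ENNReal.ofReal (f x) ^ (m + 1) := by
    rw [pos_iff_ne_zero]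
    intro h0
    rw [lintegral_eq_zero_iff (by fun_prop)] at h0
    have h1 : ∫⁻ x, ENNReal.ofReal (f x) = 0 := by
      rw [lintegral_eq_zero_iff (by fun_prop)]
      filter_upwards [h0] with x hx
      exact eq_zero_of_pow_eq_zero hx
    rw [hf_density] at h1
    exact one_ne_zero h1
  have hfatou : ∫⁻ x, ENNReal.ofReal (f x) ^ (m + 1) ≤
      liminf (fun n => ∫⁻ x, F n (cellIndex (κ * r n) x)) atTop := by
    refine le_trans (le_of_eq (lintegral_congr_ae ?_)) (lintegral_liminf_le fun n =>
      (Measurable.of_discrete (f := F n)).comp (measurable_cellIndex _))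
    filter_upwards [hlim] with x hx
    exact hx.liminf_eq.symm
  obtain ⟨c₀, hc₀, hc₀lt⟩ := exists_between hpos
  have hev := eventually_lt_of_lt_liminf (hc₀lt.trans_le hfatou)
  set ω := volume (Metric.ball (0 : E d) 1)
  have hω0 : ω ≠ 0 := (Metric.measure_ball_pos _ _ one_pos).ne'
  have hωtop : ω ≠ ⊤ := measure_ball_lt_top.ne
  set a := ENNReal.ofReal (ε ^ d) * ω
  have ha0 : a ≠ 0 := mul_ne_zero (ENNReal.ofReal_pos.2 (by positivity)).ne' hω0
  have hatop : a ≠ ⊤ := ENNReal.mul_ne_top ENNReal.ofReal_ne_top hωtop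
  set b := ENNReal.ofReal ((d * (2 * κ)) ^ d) * ω
  have hbtop : b ≠ ⊤ := ENNReal.mul_ne_top ENNReal.ofReal_ne_top hωtop
  -- `c₀` lies below the Fatou limit, `a * r ^ d` is the volume of a ball and `b * r ^ d` bounds
  -- that of a cell.
  refine ⟨c₀ * a ^ (m + 1) / b, ?_, ?_⟩
  · exact (ENNReal.div_pos (mul_ne_zero hc₀.ne' (pow_ne_zero _ ha0)) hbtop).ne'
  filter_upwards [hev, hr0] with n hn hrn
  set D := ENNReal.ofReal (r n ^ d)
  have hD0 : D ≠ 0 := (ENNReal.ofReal_pos.2 (by positivity)).ne'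
  have hDtop : D ≠ ⊤ := ENNReal.ofReal_ne_top
  have haD0 : a * D ≠ 0 := mul_ne_zero ha0 hD0
  have haDtop : a * D ≠ ⊤ := ENNReal.mul_ne_top hatop hDtop
  set S := ∑' v, ∏ i, ∫⁻ x in configBall κ ε y (r n) v i, ENNReal.ofReal (f x)
  have hF : ∀ v, F n v * (a * D) ^ (m + 1) =
      ∏ i, ∫⁻ x in configBall κ ε y (r n) v i, ENNReal.ofReal (f x) := by
    intro v
    have : (a * D) ^ (m + 1) = ∏ _i : Fin (m + 1), a * D := by simp
    rw [this, ← Finset.prod_mul_distrib]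
    refine Finset.prod_congr rfl fun i _ => ?_
    rw [ofReal_setAverage hint.integrableOn (Eventually.of_forall hf0),
      volume_configBall hε y hrn v i, ENNReal.div_mul_cancel haD0 haDtop]
  have h1 : c₀ ≤ ∑' v, F n v * (b * D) := by
    refine hn.le.trans ?_
    rw [lintegral_comp_cellIndex]
    refine ENNReal.tsum_le_tsum fun v =>
      mul_le_mul_right ((volume_cell_le (by positivity) v).trans_eq ?_) _
    rw [mul_right_comm, ← ENNReal.ofReal_mul (by positivity)]
    congr 2
    ring
  have h2 : c₀ * (a * D) ^ (m + 1) ≤ S * (b * D) := by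
    calc c₀ * (a * D) ^ (m + 1) ≤ (∑' v, F n v * (b * D)) * (a * D) ^ (m + 1) := by gcongr
      _ = ∑' v, F n v * (a * D) ^ (m + 1) * (b * D) := by
        rw [← ENNReal.tsum_mul_right]
        exact tsum_congr fun v => mul_right_comm _ _ _
      _ = S * (b * D) := by
        rw [ENNReal.tsum_mul_right]
        simp_rw [hF]
        rfl
  have h3 : c₀ * a ^ (m + 1) * D ^ m ≤ S * b := by
    rw [← ENNReal.mul_le_mul_iff_left hD0 hDtop]
    calc c₀ * a ^ (m + 1) * D ^ m * D = c₀ * (a * D) ^ (m + 1) := by ring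
      _ ≤ S * (b * D) := h2
      _ = S * b * D := by ring
  calc c₀ * a ^ (m + 1) / b * D ^ m = c₀ * a ^ (m + 1) * D ^ m / b := by
        rw [div_eq_mul_inv, div_eq_mul_inv]; ring
    _ ≤ S := ENNReal.div_le_of_le_mul h3

end LebesgueDensity

/-! ### Isolated configurations in grid cells -/

section ConfigEvent

variable {d m : ℕ}

/-- The finite set `P` has exactly one point in each ball of the configuration placed in the cell
`v` and no other points in the cell. -/
def HasConfig (κ ε : ℝ) (y : Fin m → E d) (r : ℝ) (P : Finset (E d)) (v : Fin d → ℤ) : Prop :=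
  (∀ i, ((P : Set (E d)) ∩ configBall κ ε y r v i).ncard = 1) ∧
    ((P : Set (E d)) ∩ (cellIndex (κ * r) ⁻¹' {v} \ ⋃ i, configBall κ ε y r v i)).ncard = 0

theorem measurableSet_configBall (κ ε : ℝ) (y : Fin m → E d) (r : ℝ) (v : Fin d → ℤ) (i : Fin m) :
    MeasurableSet (configBall κ ε y r v i) :=
  Metric.isClosed_closedBall.measurableSet

theorem measurableSet_cell_diff (κ ε : ℝ) (y : Fin m → E d) (r : ℝ) (v : Fin d → ℤ) :
    MeasurableSet (cellIndex (κ * r) ⁻¹' {v} \ ⋃ i, configBall κ ε y r v i) :=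
  (measurable_cellIndex _ (MeasurableSet.singleton v)).diff
    (MeasurableSet.iUnion fun i => measurableSet_configBall κ ε y r v i)

theorem disjoint_configBall {κ ε r : ℝ} {y : Fin m → E d}
    (hy : ∀ i j, i ≠ j → 2 * ε < dist (y i) (y j)) (hr : 0 < r) (v : Fin d → ℤ) {i j : Fin m}
    (hij : i ≠ j) : Disjoint (configBall κ ε y r v i) (configBall κ ε y r v j) := by
  refine Metric.closedBall_disjoint_closedBall ?_
  rw [dist_add_left, dist_smul₀, Real.norm_of_nonneg hr.le]
  have := mul_lt_mul_of_pos_left (hy i j hij) hr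
  linarith

/-- In each coordinate the ball keeps a margin `δ * r` from the walls of its cell. This isolates the
cluster when `δ > 2 * ϑ`, and with `z = x` it shows that the ball lies in the cell. -/
theorem lt_dist_of_not_mem_cell {κ ε r δ : ℝ} {y : Fin m → E d} (hr : 0 < r) (hκ : 0 < κ)
    (hy : ∀ i j, δ + ε ≤ y i j ∧ y i j + δ + ε < κ) {v : Fin d → ℤ} {i : Fin m}
    {x z : E d} (hx : x ∈ configBall κ ε y r v i) (hz : cellIndex (κ * r) z ≠ v) :
    δ * r ≤ dist x z := by
  by_contra! hlt
  refine hz (funext fun j => ?_)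
  have h1 := (abs_le.1 ((abs_apply_sub_le x _ j).trans (Metric.mem_closedBall.1 hx)))
  have h2 := (abs_lt.1 ((abs_apply_sub_le x z j).trans_lt hlt))
  have h3 : (cellCorner (κ * r) v + r • y i) j = κ * r * v j + r * y i j := by
    simp [cellCorner]
  rw [h3] at h1
  have hκr : 0 < κ * r := by positivity
  have h4 := mul_le_mul_of_nonneg_left (hy i j).1 hr.le
  have h5 := mul_lt_mul_of_pos_left (hy i j).2 hr
  rw [cellIndex, Int.floor_eq_iff, le_div_iff₀ hκr, div_lt_iff₀ hκr]
  constructor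
  · linarith [h1.1, h2.2]
  · linarith [h1.2, h2.1]

variable {𝕜 : Type*} [Field 𝕜] {k : ℕ}

/-- The number of cells in which `P` has a configuration is at most the persistent rank. -/
theorem card_hasConfig_le {ϑ κ ε δ r : ℝ} {y : Fin m → E d} {w : E d} (hr : 0 < r) (hκ : 0 < κ)
    (hy : ∀ i j, δ + ε ≤ y i j ∧ y i j + δ + ε < κ) (hδ : 2 * ϑ < δ) (hδ0 : 0 < δ)
    (hstable : ∀ r > 0, ∀ (p : E d) (c : Fin m → E d),
      (∀ i, dist (c i) (p + r • (y i - w)) ≤ r * ε) →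
        ∀ C : Finset (E d), (∀ x, x ∈ C ↔ ∃ i, c i = x) →
          ∃ γ ∈ cycles 𝕜 (cech C r) k, γ ∉ boundaries 𝕜 (cech C (ϑ * r)) k)
    (P : Finset (E d)) (T : Finset (Fin d → ℤ)) (hT : ∀ v ∈ T, HasConfig κ ε y r P v) :
    T.card ≤ persistentRank 𝕜 (cech P r) (cech P (ϑ * r)) k := by
  classical
  have hcell : ∀ v i, ∀ x ∈ configBall κ ε y r v i, cellIndex (κ * r) x = v := by
    intro v i x hx
    by_contra hne
    have := lt_dist_of_not_mem_cell hr hκ hy hx hne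
    rw [dist_self] at this
    exact absurd (mul_pos hδ0 hr) (not_lt.2 this)
  have hmem : ∀ v ∈ T, ∀ x ∈ P, cellIndex (κ * r) x = v → ∃ i, x ∈ configBall κ ε y r v i := by
    intro v hv x hxP hx
    by_contra hne
    have h1 := (hT v hv).2
    rw [Set.ncard_eq_zero (P.finite_toSet.inter_of_left _)] at h1
    have : x ∈ (P : Set (E d)) ∩ (cellIndex (κ * r) ⁻¹' {v} \ ⋃ i, configBall κ ε y r v i) :=
      ⟨hxP, hx, by simpa using hne⟩
    rw [h1] at this
    exact this
  refine card_le_persistentRank_cech T (fun v => P.filter (cellIndex (κ * r) · = v))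
    (fun v _ => Finset.filter_subset _ _) ?_ ?_ ?_
  · intro v _ v' _ hne
    refine Finset.disjoint_left.2 fun x hx hx' => hne ?_
    rw [← (Finset.mem_filter.1 hx).2, ← (Finset.mem_filter.1 hx').2]
  · intro v hv x hx z hzP hz
    obtain ⟨hxP, hxv⟩ := Finset.mem_filter.1 hx
    obtain ⟨i, hi⟩ := hmem v hv x hxP hxv
    refine lt_of_lt_of_le ?_ (lt_dist_of_not_mem_cell hr hκ hy hi fun h =>
      hz (Finset.mem_filter.2 ⟨hzP, h⟩))
    rw [← mul_assoc]
    exact mul_lt_mul_of_pos_right hδ hr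
  · intro v hv
    have hc : ∀ i, ∃ c, (P : Set (E d)) ∩ configBall κ ε y r v i = {c} := fun i =>
      Set.ncard_eq_one.1 ((hT v hv).1 i)
    choose c hc using hc
    have hcmem : ∀ i, c i ∈ P ∧ c i ∈ configBall κ ε y r v i := fun i => by
      have : c i ∈ (P : Set (E d)) ∩ configBall κ ε y r v i := by rw [hc i]; rfl
      exact ⟨this.1, this.2⟩
    -- The base point includes `r • w` to undo the translation of the configuration by `w`.
    refine hstable r hr (cellCorner (κ * r) v + r • w) c (fun i => ?_) _ fun x => ⟨fun hx => ?_, ?_⟩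
    · have := Metric.mem_closedBall.1 (hcmem i).2
      rwa [add_assoc, ← smul_add, add_sub_cancel, mul_comm r ε]
    · obtain ⟨hxP, hxv⟩ := Finset.mem_filter.1 hx
      obtain ⟨i, hi⟩ := hmem v hv x hxP hxv
      have : x ∈ (P : Set (E d)) ∩ configBall κ ε y r v i := ⟨hxP, hi⟩
      rw [hc i] at this
      exact ⟨i, this.symm⟩
    · rintro ⟨i, rfl⟩
      exact Finset.mem_filter.2 ⟨(hcmem i).1, hcell v i _ (hcmem i).2⟩

variable {Ω : Type*} [MeasurableSpace Ω] {μ : Measure Ω} {P : Ω → Finset (E d)} {lam : E d → ℝ}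

theorem IsPoissonProcess.measurableSet_hasConfig (hP : IsPoissonProcess P lam μ) (κ ε : ℝ)
    (y : Fin m → E d) (r : ℝ) (v : Fin d → ℤ) :
    MeasurableSet {ω | HasConfig κ ε y r (P ω) v} := by
  have h1 : {ω | HasConfig κ ε y r (P ω) v} =
      (⋂ i, (fun ω => ((P ω : Set (E d)) ∩ configBall κ ε y r v i).ncard) ⁻¹' {1}) ∩
        (fun ω => ((P ω : Set (E d)) ∩
          (cellIndex (κ * r) ⁻¹' {v} \ ⋃ i, configBall κ ε y r v i)).ncard) ⁻¹' {0} := by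
    ext ω
    simp [HasConfig]
  rw [h1]
  exact (MeasurableSet.iInter fun i => hP.measurable_count _ (measurableSet_configBall κ ε y r v i)
    (MeasurableSet.singleton _)).inter (hP.measurable_count _ (measurableSet_cell_diff κ ε y r v)
    (MeasurableSet.singleton _))

/-- The probability is `Λ * exp (-Λ)`, and `exp (-Λ) ≥ exp (-1)` for `Λ ≤ 1`. -/
theorem IsPoissonProcess.le_measure_count_eq_one (hP : IsPoissonProcess P lam μ) {A : Set (E d)}
    (hA : MeasurableSet A) (hle : ∫⁻ x in A, ENNReal.ofReal (lam x) ≤ 1) :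
    ENNReal.ofReal (Real.exp (-1)) * ∫⁻ x in A, ENNReal.ofReal (lam x) ≤
      μ ((fun ω => ((P ω : Set (E d)) ∩ A).ncard) ⁻¹' {1}) := by
  have hne : ∫⁻ x in A, ENNReal.ofReal (lam x) ≠ ⊤ := (hle.trans_lt ENNReal.one_lt_top).ne
  have h1 := (hP.hasLaw_count A hA hne).measure_eq (p := fun j => j = 1) (MeasurableSet.singleton 1)
  have h2 : μ ((fun ω => ((P ω : Set (E d)) ∩ A).ncard) ⁻¹' {1}) = _ := h1
  rw [h2]
  refine le_trans ?_ (poissonMeasure_singleton _ 1).ge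
  obtain ⟨l, hl⟩ : ∃ l : ℝ≥0, (l : ℝ≥0∞) = _ := ⟨_, ENNReal.coe_toNNReal hne⟩
  rw [← hl] at hle ⊢
  rw [ENNReal.toNNReal_coe, ← ENNReal.ofReal_coe_nnreal, ← ENNReal.ofReal_mul (by positivity)]
  refine ENNReal.ofReal_le_ofReal ?_
  have hl1 : (l : ℝ) ≤ 1 := by exact_mod_cast hle
  simp only [pow_one, Nat.factorial_one, Nat.cast_one, div_one]
  gcongr

theorem IsPoissonProcess.le_measure_count_eq_zero (hP : IsPoissonProcess P lam μ) {A : Set (E d)}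
    (hA : MeasurableSet A) (hle : ∫⁻ x in A, ENNReal.ofReal (lam x) ≤ 1) :
    ENNReal.ofReal (Real.exp (-1)) ≤
      μ ((fun ω => ((P ω : Set (E d)) ∩ A).ncard) ⁻¹' {0}) := by
  have hne : ∫⁻ x in A, ENNReal.ofReal (lam x) ≠ ⊤ := (hle.trans_lt ENNReal.one_lt_top).ne
  have h1 := (hP.hasLaw_count A hA hne).measure_eq (p := fun j => j = 0) (MeasurableSet.singleton 0)
  have h2 : μ ((fun ω => ((P ω : Set (E d)) ∩ A).ncard) ⁻¹' {0}) = _ := h1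
  rw [h2]
  refine le_trans ?_ (poissonMeasure_singleton _ 0).ge
  obtain ⟨l, hl⟩ : ∃ l : ℝ≥0, (l : ℝ≥0∞) = _ := ⟨_, ENNReal.coe_toNNReal hne⟩
  rw [← hl] at hle ⊢
  rw [ENNReal.toNNReal_coe]
  refine ENNReal.ofReal_le_ofReal ?_
  have hl1 : (l : ℝ) ≤ 1 := by exact_mod_cast hle
  simp only [pow_zero, Nat.factorial_zero, Nat.cast_one, div_one, mul_one]
  gcongr

/-- The event prescribes the counts in `m` balls and in the rest of the cell. These `m + 1` regions
are disjoint, so the probabilities multiply, each contributing a factor `exp (-1)`. -/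
theorem IsPoissonProcess.le_measure_hasConfig (hP : IsPoissonProcess P lam μ) {κ ε r δ : ℝ}
    {y : Fin m → E d} (hy : ∀ i j, i ≠ j → 2 * ε < dist (y i) (y j)) (hr : 0 < r) (hκ : 0 < κ)
    (hyκ : ∀ i j, δ + ε ≤ y i j ∧ y i j + δ + ε < κ) (hδ : 0 < δ) (v : Fin d → ℤ)
    (hle : ∫⁻ x in cellStar (κ * r) v, ENNReal.ofReal (lam x) ≤ 1) :
    ENNReal.ofReal (Real.exp (-1)) ^ (m + 1) *
      ∏ i, ∫⁻ x in configBall κ ε y r v i, ENNReal.ofReal (lam x) ≤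
        μ {ω | HasConfig κ ε y r (P ω) v} := by
  have hcell : cellIndex (κ * r) ⁻¹' {v} ⊆ cellStar (d := d) (κ * r) v := by
    intro x hx i
    rw [show cellIndex (κ * r) x = v from hx]
    simp
  have hball : ∀ i, configBall κ ε y r v i ⊆ cellStar (κ * r) v := by
    refine fun i x hx => hcell ?_
    by_contra hne
    have := lt_dist_of_not_mem_cell hr hκ hyκ hx hne
    rw [dist_self] at this
    exact absurd (mul_pos hδ hr) (not_lt.2 this)
  let A : Fin (m + 1) → Set (E d) := Fin.cons
    (cellIndex (κ * r) ⁻¹' {v} \ ⋃ i, configBall κ ε y r v i) (configBall κ ε y r v)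
  have hAmeas : ∀ i, MeasurableSet (A i) := by
    refine Fin.cases ?_ fun i => ?_
    · exact measurableSet_cell_diff κ ε y r v
    · exact measurableSet_configBall κ ε y r v i
  have hAdisj : Pairwise fun i i' => Disjoint (A i) (A i') := by
    have h0 : ∀ i, Disjoint (cellIndex (κ * r) ⁻¹' {v} \ ⋃ i, configBall κ ε y r v i)
        (configBall κ ε y r v i) := fun i =>
      Set.disjoint_left.2 fun x hx hx' => hx.2 (Set.mem_iUnion.2 ⟨i, hx'⟩)
    intro i i'
    refine Fin.cases (Fin.cases ?_ (fun i' => ?_) i') (fun i => Fin.cases ?_ (fun i' => ?_) i') i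
    · exact fun h => absurd rfl h
    · exact fun _ => h0 i'
    · exact fun _ => (h0 i).symm
    · exact fun h => disjoint_configBall hy hr v fun h' => h (congrArg Fin.succ h')
  let B : Fin (m + 1) → Set ℕ := Fin.cons {0} fun _ => {1}
  have hind := (hP.indep_count (m + 1) A hAmeas hAdisj).measure_inter_preimage_eq_mul
    Finset.univ (sets := B) fun i _ => MeasurableSet.of_discrete
  have hset : {ω | HasConfig κ ε y r (P ω) v} =
      ⋂ i ∈ Finset.univ, (fun ω => ((P ω : Set (E d)) ∩ A i).ncard) ⁻¹' B i := by
    ext ω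
    simp only [Finset.mem_univ, Set.iInter_true, Set.mem_iInter, Set.mem_preimage,
      Fin.forall_fin_succ]
    exact and_comm
  rw [hset, hind, Fin.prod_univ_succ, pow_succ', mul_assoc]
  refine mul_le_mul' (hP.le_measure_count_eq_zero (measurableSet_cell_diff κ ε y r v)
    ((lintegral_mono_set (Set.sdiff_subset.trans hcell)).trans hle)) ?_
  have : ENNReal.ofReal (Real.exp (-1)) ^ m = ∏ _i : Fin m, ENNReal.ofReal (Real.exp (-1)) := by
    simp
  rw [this, ← Finset.prod_mul_distrib]
  exact Finset.prod_le_prod' fun i _ => hP.le_measure_count_eq_one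
    (measurableSet_configBall κ ε y r v i) ((lintegral_mono_set (hball i)).trans hle)

/-- The expected persistent rank is at least the expected number of configurations. -/
theorem IsPoissonProcess.tsum_measure_hasConfig_le (hP : IsPoissonProcess P lam μ)
    {κ ε r ϑ : ℝ} {y : Fin m → E d}
    (h : ∀ (Q : Finset (E d)) (T : Finset (Fin d → ℤ)), (∀ v ∈ T, HasConfig κ ε y r Q v) →
      T.card ≤ persistentRank 𝕜 (cech Q r) (cech Q (ϑ * r)) k) :
    ∑' v, μ {ω | HasConfig κ ε y r (P ω) v} ≤
      ∫⁻ ω, (persistentRank 𝕜 (cech (P ω) r) (cech (P ω) (ϑ * r)) k : ℝ≥0∞) ∂μ := by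
  classical
  rw [ENNReal.tsum_eq_iSup_sum]
  refine iSup_le fun T => ?_
  have h1 : ∀ v ∈ T, μ {ω | HasConfig κ ε y r (P ω) v} =
      ∫⁻ ω, {ω | HasConfig κ ε y r (P ω) v}.indicator 1 ω ∂μ := fun v _ =>
    (lintegral_indicator_one (hP.measurableSet_hasConfig κ ε y r v)).symm
  rw [Finset.sum_congr rfl h1, ← lintegral_finsetSum _ fun v _ =>
    measurable_one.indicator (hP.measurableSet_hasConfig κ ε y r v)]
  refine lintegral_mono fun ω => ?_
  have h2 := h (P ω) (T.filter fun v => HasConfig κ ε y r (P ω) v)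
    fun v hv => (Finset.mem_filter.1 hv).2
  refine le_trans (le_of_eq ?_) (Nat.cast_le.2 h2)
  rw [Finset.card_filter, Nat.cast_sum]
  refine Finset.sum_congr rfl fun v _ => ?_
  simp [Set.indicator_apply]

end ConfigEvent

/-! ### The expected lower bound and the limit of the radii -/

section Main

variable (𝕜 : Type*) [Field 𝕜] {d k : ℕ}

/-- The lower bound on the expected persistent rank. -/
theorem exists_le_lintegral_persistentRank {f : E d → ℝ} (hf : Measurable f) (hf0 : ∀ x, 0 ≤ f x)
    {M : ℝ} (hM : ∀ x, f x ≤ M) (hf_density : ∫⁻ x, ENNReal.ofReal (f x) = 1) {ϑ : ℝ} (hϑ : 1 ≤ ϑ)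
    {m : ℕ} (hm : m + 1 ∈ persistentCycleSizes 𝕜 d k ϑ) {Ω : ℕ → Type*}
    [∀ n, MeasurableSpace (Ω n)] {μ : ∀ n, Measure (Ω n)} {P : ∀ n, Ω n → Finset (E d)}
    (hP : ∀ n, IsPoissonProcess (P n) (fun x => n * f x) (μ n)) {r : ℕ → ℝ}
    (hr : Tendsto r atTop (𝓝[>] 0)) (hrn : Tendsto (fun n : ℕ => r n ^ d * n) atTop (𝓝 0)) :
    ∃ c : ℝ≥0∞, c ≠ 0 ∧ ∀ᶠ n in atTop, c * ENNReal.ofReal (n * (r n ^ d * n) ^ m) ≤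
      ∫⁻ ω, (persistentRank 𝕜 (cech (P n ω) (r n)) (cech (P n ω) (ϑ * r n)) k : ℝ≥0∞) ∂(μ n) := by
  obtain ⟨y₀, ε, hε, hy₀, hstable⟩ := exists_stable_configuration hϑ hm
  set R := ∑ i, ‖y₀ i‖ with hR
  have hR0 : 0 ≤ R := by positivity
  -- `δ` exceeds the isolation distance `2 * ϑ`. The cell width `κ` leaves a margin above `δ + ε` on
  -- both sides of the configuration, whose coordinates are at most `R` in absolute value, once it
  -- is centred by `w`.
  set δ := 2 * ϑ + 1 with hδ
  have hδ0 : 0 < δ := by positivity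
  set κ := 2 * (R + ε + δ) + 1 with hκ
  have hκ0 : 0 < κ := by positivity
  let w : E d := WithLp.toLp 2 fun _ => κ / 2
  let y : Fin (m + 1) → E d := fun i => y₀ i + w
  have hy : ∀ i j, i ≠ j → 2 * ε < dist (y i) (y j) := fun i j hij => by
    rw [dist_add_right]
    exact hy₀ i j hij
  have hyκ : ∀ i j, δ + ε ≤ y i j ∧ y i j + δ + ε < κ := by
    intro i j
    have h1 : |y₀ i j| ≤ R := (PiLp.norm_apply_le (y₀ i) j).trans
      (Finset.single_le_sum (f := fun i => ‖y₀ i‖) (fun _ _ => norm_nonneg _) (Finset.mem_univ i))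
    rw [abs_le] at h1
    have h2 : y i j = y₀ i j + κ / 2 := rfl
    rw [h2]
    constructor <;> linarith [h1.1, h1.2]
  have hstable' : ∀ r > 0, ∀ (p : E d) (c : Fin (m + 1) → E d),
      (∀ i, dist (c i) (p + r • (y i - w)) ≤ r * ε) →
        ∀ C : Finset (E d), (∀ x, x ∈ C ↔ ∃ i, c i = x) →
          ∃ γ ∈ cycles 𝕜 (cech C r) k, γ ∉ boundaries 𝕜 (cech C (ϑ * r)) k := by
    simpa only [y, add_sub_cancel_right] using hstable
  obtain ⟨c, hc0, hc⟩ := exists_le_tsum_prod_configBall hf hf0 hf_density y hκ0 hε hr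
  set e := ENNReal.ofReal (Real.exp (-1))
  have he0 : e ≠ 0 := (ENNReal.ofReal_pos.2 (Real.exp_pos _)).ne'
  refine ⟨e ^ (m + 1 + 1) * c, mul_ne_zero (pow_ne_zero _ he0) hc0, ?_⟩
  set B : ℝ≥0∞ := ENNReal.ofReal (|M| * (d * (2 * κ)) ^ d) * volume (Metric.ball (0 : E d) 1)
  have hBtop : B ≠ ⊤ := ENNReal.mul_ne_top ENNReal.ofReal_ne_top measure_ball_lt_top.ne
  have hsmall : ∀ᶠ n : ℕ in atTop, B * ENNReal.ofReal (r n ^ d * n) ≤ 1 := by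
    have h1 : Tendsto (fun n : ℕ => B * ENNReal.ofReal (r n ^ d * n)) atTop
        (𝓝 (B * ENNReal.ofReal 0)) :=
      ENNReal.Tendsto.const_mul (ENNReal.tendsto_ofReal hrn) (Or.inr hBtop)
    rw [ENNReal.ofReal_zero, mul_zero] at h1
    exact h1.eventually (ge_mem_nhds zero_lt_one)
  filter_upwards [hc, hsmall, hr.eventually self_mem_nhdsWithin] with n hcn hsn hrn
  have hrn' : 0 < r n := hrn
  have hscale : ∀ v i, ∫⁻ x in configBall κ ε y (r n) v i, ENNReal.ofReal (n * f x) =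
      n * ∫⁻ x in configBall κ ε y (r n) v i, ENNReal.ofReal (f x) := by
    intro v i
    simp_rw [ENNReal.ofReal_mul (Nat.cast_nonneg n)]
    rw [lintegral_const_mul _ (by fun_prop), ENNReal.ofReal_natCast]
  -- The powers match because `n * (r ^ d * n) ^ m = n ^ (m + 1) * (r ^ d) ^ m`; `e` appears once
  -- per ball and once for the empty remainder.
  calc e ^ (m + 1 + 1) * c * ENNReal.ofReal (n * (r n ^ d * n) ^ m)
      = e ^ (m + 1 + 1) * ((n : ℝ≥0∞) ^ (m + 1) * (c * ENNReal.ofReal (r n ^ d) ^ m)) := by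
        rw [ENNReal.ofReal_mul (Nat.cast_nonneg n), ENNReal.ofReal_pow (by positivity),
          ENNReal.ofReal_mul (by positivity), ENNReal.ofReal_natCast]
        ring
    _ ≤ e ^ (m + 1 + 1) * ((n : ℝ≥0∞) ^ (m + 1) *
          ∑' v, ∏ i, ∫⁻ x in configBall κ ε y (r n) v i, ENNReal.ofReal (f x)) := by gcongr
    _ = ∑' v, e ^ (m + 1 + 1) *
          ∏ i, ∫⁻ x in configBall κ ε y (r n) v i, ENNReal.ofReal (n * f x) := by
        rw [← ENNReal.tsum_mul_left, ← ENNReal.tsum_mul_left]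
        refine tsum_congr fun v => ?_
        simp_rw [hscale]
        rw [Finset.prod_mul_distrib]
        simp
    _ ≤ ∑' v, μ n {ω | HasConfig κ ε y (r n) (P n ω) v} :=
        ENNReal.tsum_le_tsum fun v => (hP n).le_measure_hasConfig hy hrn' hκ0 hyκ hδ0 v
          ((setLIntegral_cellStar_le hM hκ0 hrn' n v).trans hsn)
    _ ≤ _ := (hP n).tsum_measure_hasConfig_le
        (card_hasConfig_le hrn' hκ0 hyκ (by linarith) hδ0 hstable')

/-- This gives `m ≥ 1`, so that the exponent `m - 1` is a genuine subtraction. -/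
theorem not_formsPersistentCycle_empty {ϑ : ℝ} :
    ¬ FormsPersistentCycle 𝕜 k ϑ (∅ : Finset (E d)) := by
  rintro ⟨r, -, γ, hγ, hγ'⟩
  have : γ = 0 := by
    rw [← Finsupp.support_eq_empty, Finset.eq_empty_iff_forall_notMem]
    intro x hx
    obtain ⟨s, hs, -⟩ := (Finsupp.mem_supported _ _).1 (cycles_le_chains _ _ hγ) hx
    exact hs.1.ne_empty (Finset.subset_empty.1 hs.2.1)
  exact hγ' (this ▸ zero_mem _)

theorem tendsto_radius {r : ℕ → ℝ} (hd : d ≠ 0) (hr : ∀ n, 0 < r n)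
    (hrn : Tendsto (fun n : ℕ => r n ^ d * n) atTop (𝓝 0)) : Tendsto r atTop (𝓝[>] 0) := by
  refine tendsto_nhdsWithin_iff.2 ⟨?_, Eventually.of_forall hr⟩
  have h1 : Tendsto (fun n => r n ^ d) atTop (𝓝 0) := by
    refine tendsto_of_tendsto_of_tendsto_of_le_of_le' tendsto_const_nhds hrn
      (Eventually.of_forall fun n => by have := hr n; positivity) ?_
    filter_upwards [eventually_ge_atTop 1] with n hn
    have h2 : (1 : ℝ) ≤ n := by exact_mod_cast hn
    have := hr n
    exact le_mul_of_one_le_right (by positivity) h2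
  have h2 := h1.rpow_const (p := (d : ℝ)⁻¹) (Or.inr (by positivity))
  rw [Real.zero_rpow (by positivity)] at h2
  simpa only [Real.pow_rpow_inv_natCast (hr _).le hd] using h2

end Main

end RandomCech

end

theorem mainTheorem1 {𝕜 : Type*} [Field 𝕜] {d k : ℕ} (hd : 2 ≤ d) (hk : 1 ≤ k) (hkd : k ≤ d - 1)
    {ϑ : ℝ} (hϑ : 1 ≤ ϑ)
    (f : RandomCech.E d → ℝ) (hf_meas : Measurable f) (hf_nonneg : ∀ x, 0 ≤ f x)
    (hf_bdd : ∃ C, ∀ x, f x ≤ C) (hf_density : ∫ x, f x = 1)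
    {Ω : ℕ → Type*} [∀ n, MeasurableSpace (Ω n)] (μ : ∀ n, Measure (Ω n))
    [∀ n, IsProbabilityMeasure (μ n)] (P : ∀ n, Ω n → Finset (RandomCech.E d))
    (hP : ∀ n, RandomCech.IsPoissonProcess (P n) (fun x => n * f x) (μ n))
    (r : ℕ → ℝ) (hr : ∀ n, 0 < r n)
    (hrn : Tendsto (fun n : ℕ => r n ^ d * n) atTop (𝓝 0)) :
    IsLeast (RandomCech.persistentCycleSizes 𝕜 d k ϑ) (RandomCech.minCycleSize 𝕜 d k ϑ) ∧
    (∀ n, Integrable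
      (fun ω => (RandomCech.persistentBetti 𝕜 k hϑ (hr n).le (P n ω) : ℝ)) (μ n)) ∧
    (fun n : ℕ => ∫ ω, (RandomCech.persistentBetti 𝕜 k hϑ (hr n).le (P n ω) : ℝ) ∂(μ n))
      =Θ[atTop]
    (fun n : ℕ => (n : ℝ) * (r n ^ d * n) ^ (RandomCech.minCycleSize 𝕜 d k ϑ - 1)) := by
  have hsizes := RandomCech.persistentCycleSizes_nonempty 𝕜 (show k + 1 ≤ d by omega) hk hϑ
  have hmem := Nat.sInf_mem hsizes
  have hmpos : 1 ≤ RandomCech.minCycleSize 𝕜 d k ϑ := by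
    by_contra h0
    obtain ⟨Q, hQ, hcard⟩ := hmem
    have hQ0 : Q.card = 0 := by
      rw [hcard]
      exact Nat.lt_one_iff.1 (not_le.1 h0)
    rw [Finset.card_eq_zero.1 hQ0] at hQ
    exact RandomCech.not_formsPersistentCycle_empty 𝕜 hQ
  obtain ⟨M, hM⟩ := hf_bdd
  -- A non-integrable `f` would have Bochner integral 0 rather than 1.
  have hf_int : Integrable f := by
    by_contra h
    rw [integral_undef h] at hf_density
    exact zero_ne_one hf_density
  have hf_one : ∫⁻ x, ENNReal.ofReal (f x) = 1 := by
    rw [← ofReal_integral_eq_lintegral_ofReal hf_int (Eventually.of_forall hf_nonneg), hf_density,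
      ENNReal.ofReal_one]
  have hint : ∀ n, Integrable
      (fun ω => (RandomCech.persistentBetti 𝕜 k hϑ (hr n).le (P n ω) : ℝ)) (μ n) := by
    intro n
    simp only [RandomCech.persistentBetti, RandomCech.finrank_range_homologyMap]
    refine (hP n).integrable_persistentRank 𝕜 ?_ (hr n)
    rw [RandomCech.lintegral_nat_mul_density hf_meas hf_one]
    exact ENNReal.natCast_ne_top n
  have hlint : ∀ n, ENNReal.ofReal
      (∫ ω, (RandomCech.persistentBetti 𝕜 k hϑ (hr n).le (P n ω) : ℝ) ∂(μ n)) =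
      ∫⁻ ω, (RandomCech.persistentRank 𝕜 (RandomCech.cech (P n ω) (r n))
        (RandomCech.cech (P n ω) (ϑ * r n)) k : ENNReal) ∂(μ n) := by
    intro n
    rw [ofReal_integral_eq_lintegral_ofReal (hint n)
      (Eventually.of_forall fun _ => Nat.cast_nonneg _)]
    simp only [RandomCech.persistentBetti, RandomCech.finrank_range_homologyMap,
      ENNReal.ofReal_natCast]
  have hnonneg : ∀ n, 0 ≤ ∫ ω, (RandomCech.persistentBetti 𝕜 k hϑ (hr n).le (P n ω) : ℝ) ∂(μ n) :=
    fun n => integral_nonneg fun _ => Nat.cast_nonneg _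
  have hrate : ∀ n : ℕ, 0 ≤ (n : ℝ) * (r n ^ d * n) ^ (RandomCech.minCycleSize 𝕜 d k ϑ - 1) :=
    fun n => by have := hr n; positivity
  refine ⟨⟨hmem, fun j hj => Nat.sInf_le hj⟩, hint, ?_, ?_⟩
  · obtain ⟨A, hA, ε, hε, hAε⟩ :=
      RandomCech.exists_lintegral_persistentRank_le 𝕜 hf_meas hM hf_one hmpos
    refine IsBigO.of_bound A.toReal ?_
    filter_upwards [hrn.eventually (ge_mem_nhds hε)] with n hn
    rw [Real.norm_of_nonneg (hnonneg n), Real.norm_of_nonneg (hrate n),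
      ← ENNReal.ofReal_le_ofReal_iff (mul_nonneg ENNReal.toReal_nonneg (hrate n)), hlint,
      ENNReal.ofReal_mul ENNReal.toReal_nonneg, ENNReal.ofReal_toReal hA]
    exact hAε n (r n) (hr n) hn (hP n)
  · obtain ⟨c, hc0, hc⟩ := RandomCech.exists_le_lintegral_persistentRank 𝕜 hf_meas hf_nonneg hM
      hf_one hϑ (m := RandomCech.minCycleSize 𝕜 d k ϑ - 1)
      (by rw [Nat.sub_add_cancel hmpos]; exact hmem) hP
      (RandomCech.tendsto_radius (by omega) hr hrn) hrn
    -- Truncation at 1 makes the constant finite, so its real value is positive.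
    have hc' : min c 1 ≠ ⊤ := ne_top_of_le_ne_top ENNReal.one_ne_top (min_le_right _ _)
    have hc0' : min c 1 ≠ 0 := (lt_min (pos_iff_ne_zero.2 hc0) one_pos).ne'
    have hpos := ENNReal.toReal_pos hc0' hc'
    refine IsBigO.of_bound (min c 1).toReal⁻¹ ?_
    filter_upwards [hc] with n hn
    rw [Real.norm_of_nonneg (hnonneg n), Real.norm_of_nonneg (hrate n), le_inv_mul_iff₀ hpos,
      ← ENNReal.ofReal_le_ofReal_iff (hnonneg n), hlint,
      ENNReal.ofReal_mul ENNReal.toReal_nonneg, ENNReal.ofReal_toReal hc']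
    exact (mul_le_mul_left (min_le_left c 1) _).trans hn
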